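/- Let $\mathcal Z$ be a measurable outcome space with a reference measure $dz$ (e.g. counting measure if $\mathcal Z$ is countable, Lebesgue measure if $\mathcal Z\subseteq\mathbb R^k$), let $X:\mathcal Z\to\mathbb R$ and $h:\mathcal Z\to[0,\infty)$ be measurable, put $\mathrm Z(\eta)=\int_{\mathcal Z}e^{-\eta X(z)}h(z)\,dz$ and $\Theta_\eta=\{\eta\in\mathbb R:\mathrm Z(\eta)<\infty\}$, and let $\mathcal M$ be the one-parameter exponential family of distributions with densities $M_\eta(z)=e^{-\eta X(z)}h(z)/\mathrm Z(\eta)$, $\eta\in\Theta_\eta$. Assume that $\mathcal M$ is regular ($\Theta_\eta$ is an open interval) and that $\eta\mapsto M_\eta$ is one-to-one. Let $\Theta_\mu=\{E_{M_\eta}[X]:\eta\in\Theta_\eta\}$ be the mean-value parameter space and write $M_\mu$, $\mu\in\Theta_\mu$, for the element of $\mathcal M$ with mean $E[X]=\mu$. Fix $x_0\in\Theta_\mu$ and a real number $n_0>0$. For $z^n=(z_1,\dots,z_n)$ put $$\hat\mu(z^n)=\frac{x_0n_0+\sum_{i=1}^nX(z_i)}{n+n_0},\qquad L_U(z^n)=\sum_{i=0}^{n-1}-\ln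 M_{\hat\mu(z^i)}(z_{i+1}),$$ the codelength of the prequential ML code $U$ with fake initial outcome $x_0$ of multiplicity $n_0$. Let $P$ be any probability distribution on $\mathcal Z$, let $Z_1,Z_2,\dots$ be i.i.d. $\sim P$, and suppose $E_P[X]=\mu^*\in\Theta_\mu$. For the quantities below to be well defined, assume that $h(Z)>0$ $P$-almost surely and $E_P|\ln h(Z)|<\infty$ (so that codelengths under $\mathcal M$ have finite expectation), and that $X(Z)$ lies $P$-almost surely in the closure of $\Theta_\mu$ (so that almost surely $\hat\mu(Z^n)\in\Theta_\mu$ for all $n$). The relative redundancy of $U$ is $$\mathcal R_U(n)=E_P[L_U(Z^n)]-\inf_{\mu\in\Theta_\mu}E_P[-\ln M_\mu(Z^n)].$$ Suppose that the following holds both for $T:=X$ and for $T:=-X$, where for $T=-X$ the family is parameterized by the mean of $-X$, i.e. $\mu,\mu^*,\Theta_\mu,M_\mu$ below are replaced by $-\mu,-\mu^*,-\Theta_\mu$ and the element of $\mathcal M$ under which $-X$ has the indicated mean: 1. if $T$ is not $P$-almost surely bounded from above, then there is a $k\in\{4,6,8,\dots\}$ such that the first $k$ moments of $T$ exist under $P$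 and $\frac{d^4}{d\mu^4}D(M_{\mu^*}\|M_\mu)=O(\mu^{k-6})$ as $\mu\to\infty$; 2. if $T$ is $P$-almost surely bounded from above, then there are a constant $g$ with $T\le g$ $P$-almost surely and a polynomial $p$ such that $\left|\frac{d^4}{d\mu^4}D(M_{\mu^*}\|M_\mu)\right|\le p\!\left(\frac1{g-\mu}\right)$ for all $\mu\in\Theta_\mu$ with $\mu^*\le\mu<g$. Then, for every $n$, $L_U(Z^n)$ and all $-\ln M_\mu(Z^n)$, $\mu\in\Theta_\mu$, have finite expectation, the infimum above is finite, and as $n\to\infty$ $$\mathcal R_U(n)=\frac{\operatorname{var}_PX}{\operatorname{var}_{M_{\mu^*}}X}\cdot\frac12\ln n+O(1).$$ -/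

import Mathlib

open MeasureTheory ProbabilityTheory Filter Topology Asymptotics
open scoped NNReal ENNReal

noncomputable section

/-- The data of a one-parameter exponential family on an outcome space `𝒵`: a reference measure
(counting measure for a countable `𝒵`, Lebesgue measure for a subset of Euclidean space), a
sufficient statistic `X` and a carrier `h : 𝒵 → [0, ∞)`. -/
structure ExpFamily (𝒵 : Type*) [MeasurableSpace 𝒵] where
  base : Measure 𝒵
  X : 𝒵 → ℝ
  h : 𝒵 → ℝ≥0
  measurable_X : Measurable X
  measurable_h : Measurable h

namespace ExpFamily

variable {𝒵 : Type*} [MeasurableSpace 𝒵] (F : ExpFamily 𝒵)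

/-- The normalizer `Z(η) = ∫ exp (-η X(z)) h(z) dz`, in `[0, ∞]`. -/
def partitionFn (η : ℝ) : ℝ≥0∞ :=
  ∫⁻ z, ENNReal.ofReal (Real.exp (-η * F.X z) * F.h z) ∂F.base

/-- The natural parameter space `{η | Z(η) < ∞}`. -/
def naturalSpace : Set ℝ := {η | F.partitionFn η < ∞}

/-- The density `M_η(z) = exp (-η X(z)) h(z) / Z(η)`. -/
def density (η : ℝ) (z : 𝒵) : ℝ :=
  Real.exp (-η * F.X z) * F.h z / (F.partitionFn η).toReal

/-- The distribution `M_η`. -/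
def dist (η : ℝ) : Measure 𝒵 :=
  F.base.withDensity (fun z => ENNReal.ofReal (F.density η z))

/-- The family is regular: the natural parameter space is an open interval. -/
def IsRegular : Prop := IsOpen F.naturalSpace ∧ F.naturalSpace.OrdConnected

/-- The map from natural parameters to distributions is one-to-one. -/
def IsIdentifiable : Prop := Set.InjOn F.dist F.naturalSpace

/-- The mean value map `η ↦ E_{M_η}[X]`. -/
def mean (η : ℝ) : ℝ := ∫ z, F.X z ∂(F.dist η)

/-- The mean value parameter space. -/
def meanSpace : Set ℝ := F.mean '' F.naturalSpace

/-- The natural parameter with mean `μ`, for `μ` in the mean value parameter space. -/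
def natParam (μ : ℝ) : ℝ := Function.invFunOn F.mean F.naturalSpace μ

/-- The distribution `M_μ`, in the mean value parameterization. -/
def meanDist (μ : ℝ) : Measure 𝒵 := F.dist (F.natParam μ)

/-- The density of `M_μ`, in the mean value parameterization. -/
def meanDensity (μ : ℝ) (z : 𝒵) : ℝ := F.density (F.natParam μ) z

/-- The Kullback-Leibler divergence `D(M_μ' ‖ M_μ)`. -/
def divergence (μ' μ : ℝ) : ℝ :=
  (InformationTheory.klDiv (F.meanDist μ') (F.meanDist μ)).toReal

/-- The modified maximum likelihood estimator `(x₀ n₀ + ∑_{i ≤ n} X(z_i)) / (n + n₀)`. -/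
def estimator (x₀ n₀ : ℝ) {n : ℕ} (z : Fin n → 𝒵) : ℝ :=
  (x₀ * n₀ + ∑ i, F.X (z i)) / (n + n₀)

/-- The codelength `L_U(z^n) = ∑_{i < n} -ln M_{μ̂(z^i)}(z_{i+1})` of the prequential ML code. -/
def preqLength (x₀ n₀ : ℝ) {n : ℕ} (z : Fin n → 𝒵) : ℝ :=
  ∑ i : Fin n, -Real.log
    (F.meanDensity (F.estimator x₀ n₀ (fun j : Fin i => z (Fin.castLE i.isLt.le j))) (z i))

/-- The codelength `-ln M_μ(z^n)` of the element of the family with mean `μ`. -/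
def codeLength (μ : ℝ) {n : ℕ} (z : Fin n → 𝒵) : ℝ :=
  -Real.log (∏ i, F.meanDensity μ (z i))

/-- The relative redundancy `E_P[L_U(Z^n)] - inf_μ E_P[-ln M_μ(Z^n)]` of the prequential ML code,
for `Z^n` distributed according to the `n`-fold product of `P`. -/
def redundancy (P : Measure 𝒵) (x₀ n₀ : ℝ) (n : ℕ) : ℝ :=
  (∫ z, F.preqLength x₀ n₀ z ∂(Measure.pi fun _ : Fin n => P)) -
    ⨅ μ : F.meanSpace, ∫ z, F.codeLength (μ : ℝ) z ∂(Measure.pi fun _ : Fin n => P)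

/-- The requirement on one statistic `T` with mean `τ`, mean value space `Θ` and divergence `f`.
* If `T` is not (almost surely) bounded from above, then for some `k ∈ {4, 6, …}` the first `k`
  moments of `T` exist and the fourth derivative of `f` is `O(μ^(k-6))` as `μ → ∞`.
* If `T` is bounded from above, then for some upper bound `g` the fourth derivative of `f` is, on
  the part of `Θ` between `τ` and `g`, bounded in absolute value by a polynomial in `1/(g-μ)`. -/
def TailCondition (P : Measure 𝒵) (T : 𝒵 → ℝ) (Θ : Set ℝ) (τ : ℝ) (f : ℝ → ℝ) : Prop :=
  ((¬ ∃ g : ℝ, ∀ᵐ z ∂P, T z ≤ g) →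
    ∃ k : ℕ, 4 ≤ k ∧ Even k ∧ (∀ j ≤ k, Integrable (fun z => T z ^ j) P) ∧
      (fun μ => iteratedDeriv 4 f μ) =O[atTop] (fun μ : ℝ => μ ^ ((k : ℤ) - 6))) ∧
  ((∃ g : ℝ, ∀ᵐ z ∂P, T z ≤ g) →
    ∃ g : ℝ, (∀ᵐ z ∂P, T z ≤ g) ∧ ∃ p : Polynomial ℝ,
      ∀ μ ∈ Θ, τ ≤ μ → μ < g → |iteratedDeriv 4 f μ| ≤ p.eval (1 / (g - μ)))

/-- The moment and growth condition on the family and on `P`, imposed both on `T = X` and on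
`T = -X` (with the family then parameterized by the mean of `-X`). -/
def GrowthCondition (P : Measure 𝒵) (μs : ℝ) : Prop :=
  TailCondition P F.X F.meanSpace μs (fun μ => F.divergence μs μ) ∧
  TailCondition P (fun z => -F.X z) {μ | -μ ∈ F.meanSpace} (-μs)
    (fun μ => F.divergence μs (-μ))

end ExpFamily

end

/-! ### Moments of centred i.i.d. sums and of the estimator. -/

section IidMoments

variable {Ω : Type*} [MeasurableSpace Ω]

/-! Write D(μ) for the divergence of M_μ from M_μ*. Since -ln M_μ(z) is, up to ln h(z), affine in
X(z), it equals -ln M_μ*(z) + D(μ) plus a multiple of X(z) - μ*, and that last term has P-mean zero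
whether or not P belongs to the family (`neg_log_meanDensity_eq_divergence`). Hence the infimum is
attained at μ*, and because the estimator from i outcomes is independent of the next outcome, the
redundancy is exactly the sum over i < n of E_P[D(μ̂(Z^i))].

It remains to expand each summand as a/(i+1) + O(1/(i+1)^2) with a = var_P X / (2 var_{M_μ*} X)
(`integrable_divergence_estimator`) and to compare with harmonic numbers (`sum_sub_mul_log_isBigO`).
In the Taylor expansion of D at μ*, value and slope vanish and the second derivative is the inverse
model variance, so the quadratic term gives the main part. The cubic term contributes only O(n^-2),
because the third moment of a centred i.i.d. sum is O(n), not just O(n^(3/2)).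

The growth condition controls the remainder D''''(ξ)(μ̂ - μ*)^4/24
(`rightRemainderBounded_of_tailCondition`). If T is unbounded above, polynomial growth of D''''
leaves only moments that exist and are O(n^-2). If T is bounded above, D'''' may blow up at the
bound, but the fake outcome makes the blow-up at most polynomial in n, and deviations of μ̂ by a
fixed δ are exponentially rare. The left side of μ* follows by passing from X to -X. -/

theorem measurePreserving_init_last (P : Measure Ω) [IsProbabilityMeasure P] (n : ℕ) :
    MeasurePreserving
      (fun z : Fin (n + 1) → Ω => ((fun j : Fin n => z j.castSucc), z (Fin.last n)))
      (Measure.pi fun _ => P) ((Measure.pi fun _ => P).prod P) := by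
  have h := measurePreserving_piFinSuccAbove (fun _ : Fin (n + 1) => P) (Fin.last n)
  have h2 := (Measure.measurePreserving_swap (μ := P)
    (ν := Measure.pi fun _ : Fin n => P)).comp h
  convert! h2 using 1
  ext z
  · simp [MeasurableEquiv.piFinSuccAbove, Fin.init]
  · simp [MeasurableEquiv.piFinSuccAbove]

theorem integrable_pi_succ {P : Measure Ω} [IsProbabilityMeasure P] {n : ℕ}
    {g : (Fin n → Ω) × Ω → ℝ}
    (hg : Integrable g ((Measure.pi fun _ : Fin n => P).prod P)) :
    Integrable (fun z : Fin (n + 1) → Ω => g (fun j => z j.castSucc, z (Fin.last n)))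
      (Measure.pi fun _ => P) :=
  (measurePreserving_init_last P n).integrable_comp_of_integrable hg

theorem integral_pi_succ {P : Measure Ω} [IsProbabilityMeasure P] {n : ℕ}
    {g : (Fin n → Ω) × Ω → ℝ}
    (hg : AEStronglyMeasurable g ((Measure.pi fun _ : Fin n => P).prod P)) :
    ∫ z : Fin (n + 1) → Ω, g (fun j => z j.castSucc, z (Fin.last n)) ∂(Measure.pi fun _ => P) =
      ∫ w, g w ∂((Measure.pi fun _ : Fin n => P).prod P) := by
  have h := measurePreserving_init_last P n
  rw [← h.map_eq] at hg ⊢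
  exact (integral_map h.measurable.aemeasurable hg).symm

theorem integrable_sum_pow {P : Measure Ω} [IsProbabilityMeasure P] {Y : Ω → ℝ} {k : ℕ}
    (hY : ∀ j ≤ k, Integrable (fun x => Y x ^ j) P) (n : ℕ) :
    ∀ m ≤ k, Integrable (fun z : Fin n → Ω => (∑ i, Y (z i)) ^ m) (Measure.pi fun _ => P) := by
  induction n with
  | zero => intro m _; simp
  | succ n ih =>
    intro m hm
    have h : Integrable (fun w : (Fin n → Ω) × Ω => (∑ i, Y (w.1 i) + Y w.2) ^ m)
        ((Measure.pi fun _ : Fin n => P).prod P) := by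
      simp_rw [add_pow]
      refine integrable_finsetSum _ fun j hj => Integrable.mul_const ?_ _
      have hj' : j ≤ m := Nat.lt_succ_iff.mp (Finset.mem_range.mp hj)
      exact (ih j (hj'.trans hm)).mul_prod (hY (m - j) (by omega))
    simpa [Fin.sum_univ_castSucc] using integrable_pi_succ h

theorem integral_sum_pow_succ {P : Measure Ω} [IsProbabilityMeasure P] {Y : Ω → ℝ} {k : ℕ}
    (hY : ∀ j ≤ k, Integrable (fun x => Y x ^ j) P) (n m : ℕ) (hm : m ≤ k) :
    ∫ z : Fin (n + 1) → Ω, (∑ i, Y (z i)) ^ m ∂(Measure.pi fun _ => P) =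
      ∑ j ∈ Finset.range (m + 1),
        (∫ z : Fin n → Ω, (∑ i, Y (z i)) ^ j ∂(Measure.pi fun _ => P)) *
          (∫ x, Y x ^ (m - j) ∂P) * (m.choose j) := by
  have hi : ∀ j ∈ Finset.range (m + 1),
      Integrable (fun w : (Fin n → Ω) × Ω =>
        (∑ i, Y (w.1 i)) ^ j * Y w.2 ^ (m - j) * (m.choose j))
        ((Measure.pi fun _ : Fin n => P).prod P) := fun j hj => by
    have hj' : j ≤ m := Nat.lt_succ_iff.mp (Finset.mem_range.mp hj)
    exact ((integrable_sum_pow hY n j (hj'.trans hm)).mul_prod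
      (hY (m - j) (by omega))).mul_const _
  have h := integral_pi_succ (P := P) (n := n)
    (g := fun w => (∑ i, Y (w.1 i) + Y w.2) ^ m) (by
      simp_rw [add_pow]
      exact (integrable_finsetSum _ hi).aestronglyMeasurable)
  simp_rw [Fin.sum_univ_castSucc]
  rw [h]
  simp_rw [add_pow]
  rw [integral_finsetSum _ hi]
  refine Finset.sum_congr rfl fun j _ => ?_
  rw [integral_mul_const,
    integral_prod_mul (fun z : Fin n → Ω => (∑ i, Y (z i)) ^ j) (fun x => Y x ^ (m - j))]

theorem integral_sum_sq {P : Measure Ω} [IsProbabilityMeasure P] {Y : Ω → ℝ}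
    (hY : ∀ j ≤ 2, Integrable (fun x => Y x ^ j) P) (h0 : ∫ x, Y x ∂P = 0) (n : ℕ) :
    ∫ z : Fin n → Ω, (∑ i, Y (z i)) ^ 2 ∂(Measure.pi fun _ => P) = n * ∫ x, Y x ^ 2 ∂P := by
  induction n with
  | zero => simp
  | succ n ih =>
    rw [integral_sum_pow_succ hY n 2 le_rfl]
    simp [Finset.sum_range_succ, ih, h0]
    ring

theorem integral_sum_eq_zero {P : Measure Ω} [IsProbabilityMeasure P] {Y : Ω → ℝ}
    (hY : Integrable Y P) (h0 : ∫ x, Y x ∂P = 0) (n : ℕ) :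
    ∫ z : Fin n → Ω, (∑ i, Y (z i)) ∂(Measure.pi fun _ => P) = 0 := by
  induction n with
  | zero => simp
  | succ n ih =>
    have hY' : ∀ j ≤ 1, Integrable (fun x => Y x ^ j) P := by
      intro j hj
      interval_cases j <;> simp [hY]
    have := integral_sum_pow_succ hY' n 1 le_rfl
    simpa [Finset.sum_range_succ, ih, h0] using this

/-- The `m`-th moment of a sum of `n` centred i.i.d. variables is `O(n ^ ⌊m / 2⌋)`. -/
theorem exists_abs_integral_sum_pow_le {P : Measure Ω} [IsProbabilityMeasure P] {Y : Ω → ℝ}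
    {k : ℕ} (hY : ∀ j ≤ k, Integrable (fun x => Y x ^ j) P) (h0 : ∫ x, Y x ∂P = 0) (m : ℕ) :
    m ≤ k → ∃ C : ℝ, 0 ≤ C ∧ ∀ n : ℕ,
      |∫ z : Fin n → Ω, (∑ i, Y (z i)) ^ m ∂(Measure.pi fun _ => P)| ≤ C * (n : ℝ) ^ (m / 2) := by
  induction m using Nat.strong_induction_on with
  | _ m ih =>
  intro hm
  match m, ih, hm with
  | 0, _, _ => exact ⟨1, by simp, fun n => by simp⟩
  | 1, _, hm =>
    refine ⟨0, le_rfl, fun n => ?_⟩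
    have := integral_sum_eq_zero (by simpa using hY 1 hm) h0 n
    simp [this]
  | q + 2, ih, hm =>
    choose! C hC0 hC using fun j (hj : j < q + 2) => ih j hj (by omega)
    -- Adding one outcome to the sum and expanding binomially, the term j = q + 1 contains E[Y] = 0
    -- and the term j = q + 2 is the previous moment. The remaining terms have j ≤ q, so the
    -- increment is at most K (n + 1)^(q / 2), and summing over n raises the exponent by one.
    set K : ℝ := ∑ j ∈ Finset.range (q + 1),
      C j * |∫ x, Y x ^ (q + 2 - j) ∂P| * ((q + 2).choose j) with hK
    have hK0 : 0 ≤ K := Finset.sum_nonneg fun j hj => by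
      have := hC0 j (by have := Finset.mem_range.mp hj; omega)
      positivity
    refine ⟨K, hK0, fun n => ?_⟩
    have hq : (q + 2) / 2 = q / 2 + 1 := by omega
    induction n with
    | zero => simp [hq]
    | succ n ihn =>
      rw [integral_sum_pow_succ hY n (q + 2) hm, Finset.sum_range_succ, Finset.sum_range_succ]
      have e1 : q + 2 - (q + 1) = 1 := by omega
      simp only [e1, pow_one, h0, mul_zero, zero_mul, add_zero, Nat.sub_self, pow_zero,
        integral_const, probReal_univ, smul_eq_mul, mul_one, Nat.choose_self, Nat.cast_one]
      have hsum : |∑ j ∈ Finset.range (q + 1),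
          (∫ z : Fin n → Ω, (∑ i, Y (z i)) ^ j ∂(Measure.pi fun _ => P)) *
          (∫ x, Y x ^ (q + 2 - j) ∂P) * ((q + 2).choose j)| ≤ K * ((n : ℝ) + 1) ^ (q / 2) := by
        refine (Finset.abs_sum_le_sum_abs _ _).trans ?_
        rw [hK, Finset.sum_mul]
        refine Finset.sum_le_sum fun j hj => ?_
        have hj' := Finset.mem_range.mp hj
        have hCj := hC0 j (by omega)
        rw [abs_mul, abs_mul, Nat.abs_cast]
        have h1 : (n : ℝ) ^ (j / 2) ≤ ((n : ℝ) + 1) ^ (q / 2) :=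
          (pow_le_pow_left₀ (by positivity) (by linarith) _).trans
            (pow_le_pow_right₀ (by linarith [Nat.cast_nonneg (α := ℝ) n])
              (Nat.div_le_div_right (by omega)))
        have h2 := (hC j (by omega) n).trans (mul_le_mul_of_nonneg_left h1 hCj)
        calc _ ≤ C j * ((n : ℝ) + 1) ^ (q / 2) * |∫ x, Y x ^ (q + 2 - j) ∂P| *
              ((q + 2).choose j) := by gcongr
          _ = _ := by ring
      refine (abs_add_le _ _).trans ((add_le_add hsum ihn).trans ?_)
      rw [hq]
      push_cast
      have h3 : (n : ℝ) ^ (q / 2) ≤ ((n : ℝ) + 1) ^ (q / 2) :=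
        pow_le_pow_left₀ (by positivity) (by linarith) _
      have h4 : K * ((n : ℝ) ^ (q / 2) * n) ≤ K * (((n : ℝ) + 1) ^ (q / 2) * n) := by gcongr
      rw [pow_succ, pow_succ]
      linarith

/-- The sample mean of `T`, with a fake initial outcome `x₀` of multiplicity `n₀`. -/
noncomputable def shrunkMean {Ω : Type*} (T : Ω → ℝ) (x₀ n₀ : ℝ) {n : ℕ} (z : Fin n → Ω) : ℝ :=
  (x₀ * n₀ + ∑ i, T (z i)) / (n + n₀)

theorem shrunkMean_sub {Ω : Type*} (T : Ω → ℝ) (x₀ τ : ℝ) {n₀ : ℝ} (hn₀ : 0 < n₀) {n : ℕ} (z : Fin n → Ω) :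
    shrunkMean T x₀ n₀ z - τ = ((x₀ - τ) * n₀ + ∑ i, (T (z i) - τ)) / (n + n₀) := by
  have : (n : ℝ) + n₀ ≠ 0 := by positivity
  unfold shrunkMean
  rw [Finset.sum_sub_distrib]
  simp
  field_simp
  ring

theorem measurable_shrunkMean {T : Ω → ℝ} (hT : Measurable T) (x₀ n₀ : ℝ) (n : ℕ) :
    Measurable (fun z : Fin n → Ω => shrunkMean T x₀ n₀ z) := by
  unfold shrunkMean
  fun_prop

theorem integrable_sub_pow {P : Measure Ω} [IsProbabilityMeasure P] {T : Ω → ℝ} {k : ℕ}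
    (hT : ∀ j ≤ k, Integrable (fun x => T x ^ j) P) (τ : ℝ) :
    ∀ j ≤ k, Integrable (fun x => (T x - τ) ^ j) P := by
  intro j hj
  simp_rw [sub_eq_add_neg, add_pow]
  exact integrable_finsetSum _ fun i hi =>
    ((hT i (by have := Finset.mem_range.mp hi; omega)).mul_const _).mul_const _

theorem add_one_le_mul_add (n : ℕ) {n₀ : ℝ} (hn₀ : 0 < n₀) :
    (n : ℝ) + 1 ≤ (1 + n₀⁻¹) * (n + n₀) := by
  have hn : (0 : ℝ) ≤ n := by positivity
  have h : (1 + n₀⁻¹) * (n + n₀) = n + 1 + n₀ + n₀⁻¹ * n := by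
    field_simp
    ring
  rw [h]
  have : 0 ≤ n₀⁻¹ * n := by positivity
  linarith

section

variable {P : Measure Ω} [IsProbabilityMeasure P] {T : Ω → ℝ} {k : ℕ} {x₀ τ n₀ : ℝ}

theorem integrable_shrunkMean_sub_pow (hT : ∀ j ≤ k, Integrable (fun x => T x ^ j) P)
    (hn₀ : 0 < n₀) {m : ℕ} (hm : m ≤ k) (n : ℕ) :
    Integrable (fun z : Fin n → Ω => (shrunkMean T x₀ n₀ z - τ) ^ m) (Measure.pi fun _ => P) := by
  simp_rw [shrunkMean_sub T x₀ τ hn₀, div_pow, add_comm ((x₀ - τ) * n₀), add_pow]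
  refine Integrable.div_const (integrable_finsetSum _ fun i hi => ?_) _
  exact ((integrable_sum_pow (integrable_sub_pow hT τ) n i
    (by have := Finset.mem_range.mp hi; omega)).mul_const _).mul_const _

/-- The m-th moment of the sum is of order n^⌊m/2⌋, and division by (n + n₀)^m leaves at most n^-2
exactly because ⌊m/2⌋ + 2 ≤ m for m ≥ 3. The fake outcome adds the constant d to the sum, which only
produces lower moments. -/
theorem exists_abs_integral_shrunkMean_sub_pow_le
    (hT : ∀ j ≤ k, Integrable (fun x => T x ^ j) P) (h0 : ∫ x, (T x - τ) ∂P = 0)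
    (hn₀ : 0 < n₀) {m : ℕ} (h3 : 3 ≤ m) (hm : m ≤ k) :
    ∃ C : ℝ, 0 ≤ C ∧ ∀ n : ℕ,
      |∫ z : Fin n → Ω, (shrunkMean T x₀ n₀ z - τ) ^ m ∂(Measure.pi fun _ => P)| ≤
        C / ((n : ℝ) + 1) ^ 2 := by
  have hY := integrable_sub_pow hT τ
  choose! C hC0 hC using fun j (hj : j ≤ k) => exists_abs_integral_sum_pow_le hY h0 j hj
  set d := (x₀ - τ) * n₀
  set K : ℝ := ∑ j ∈ Finset.range (m + 1), C j * |d| ^ (m - j) * (m.choose j) with hK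
  have hK0 : 0 ≤ K := Finset.sum_nonneg fun j hj => by
    have := hC0 j (by have := Finset.mem_range.mp hj; omega)
    positivity
  refine ⟨K * (1 + n₀⁻¹) ^ m, by positivity, fun n => ?_⟩
  have hpos : (0 : ℝ) < n + n₀ := by positivity
  have hexp : ∫ z : Fin n → Ω, (shrunkMean T x₀ n₀ z - τ) ^ m ∂(Measure.pi fun _ => P) =
      (∑ j ∈ Finset.range (m + 1),
        (∫ z : Fin n → Ω, (∑ i, (T (z i) - τ)) ^ j ∂(Measure.pi fun _ => P)) *
          d ^ (m - j) * (m.choose j)) / (n + n₀) ^ m := by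
    simp_rw [shrunkMean_sub T x₀ τ hn₀, div_pow, add_comm ((x₀ - τ) * n₀), add_pow]
    rw [integral_div, integral_finsetSum]
    · simp_rw [integral_mul_const]
      rfl
    · intro i hi
      exact ((integrable_sum_pow hY n i
        (by have := Finset.mem_range.mp hi; omega)).mul_const _).mul_const _
  have hsum : |∑ j ∈ Finset.range (m + 1),
        (∫ z : Fin n → Ω, (∑ i, (T (z i) - τ)) ^ j ∂(Measure.pi fun _ => P)) *
          d ^ (m - j) * (m.choose j)| ≤ K * ((n : ℝ) + 1) ^ (m / 2) := by
    refine (Finset.abs_sum_le_sum_abs _ _).trans ?_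
    rw [hK, Finset.sum_mul]
    refine Finset.sum_le_sum fun j hj => ?_
    have hj' := Finset.mem_range.mp hj
    have hCj := hC0 j (by omega)
    rw [abs_mul, abs_mul, Nat.abs_cast, abs_pow]
    have h1 : (n : ℝ) ^ (j / 2) ≤ ((n : ℝ) + 1) ^ (m / 2) :=
      (pow_le_pow_left₀ (by positivity) (by linarith) _).trans
        (pow_le_pow_right₀ (by linarith [Nat.cast_nonneg (α := ℝ) n])
          (Nat.div_le_div_right (by omega)))
    have h2 := (hC j (by omega) n).trans (mul_le_mul_of_nonneg_left h1 hCj)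
    calc _ ≤ C j * ((n : ℝ) + 1) ^ (m / 2) * |d| ^ (m - j) * (m.choose j) := by gcongr
      _ = _ := by ring
  rw [hexp, abs_div, abs_of_pos (pow_pos hpos m), div_le_div_iff₀ (by positivity) (by positivity)]
  have hle : ((n : ℝ) + 1) ^ (m / 2) * ((n : ℝ) + 1) ^ 2 ≤ ((n : ℝ) + 1) ^ m := by
    rw [← pow_add]
    exact pow_le_pow_right₀ (by linarith [Nat.cast_nonneg (α := ℝ) n]) (by omega)
  have hle2 : ((n : ℝ) + 1) ^ m ≤ (1 + n₀⁻¹) ^ m * (n + n₀) ^ m := by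
    rw [← mul_pow]
    exact pow_le_pow_left₀ (by positivity) (add_one_le_mul_add n hn₀) m
  calc _ ≤ K * ((n : ℝ) + 1) ^ (m / 2) * ((n : ℝ) + 1) ^ 2 := by gcongr
    _ = K * (((n : ℝ) + 1) ^ (m / 2) * ((n : ℝ) + 1) ^ 2) := by ring
    _ ≤ K * ((1 + n₀⁻¹) ^ m * (n + n₀) ^ m) :=
      mul_le_mul_of_nonneg_left (hle.trans hle2) hK0
    _ = _ := by ring

/-- The second moment is exactly (d² + n s) / (n + n₀)², as the cross term is centred. The
comparison is with s / (n + 1) so that n = 0 is covered. -/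
theorem exists_abs_integral_shrunkMean_sub_sq_le
    (hT : ∀ j ≤ 2, Integrable (fun x => T x ^ j) P) (h0 : ∫ x, (T x - τ) ∂P = 0)
    (hn₀ : 0 < n₀) :
    ∃ C : ℝ, 0 ≤ C ∧ ∀ n : ℕ,
      |∫ z : Fin n → Ω, (shrunkMean T x₀ n₀ z - τ) ^ 2 ∂(Measure.pi fun _ => P) -
        (∫ x, (T x - τ) ^ 2 ∂P) / (n + 1)| ≤ C / ((n : ℝ) + 1) ^ 2 := by
  have hY := integrable_sub_pow hT τ
  set d := (x₀ - τ) * n₀ with hd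
  set s := ∫ x, (T x - τ) ^ 2 ∂P with hs
  have hs0 : 0 ≤ s := integral_nonneg fun x => sq_nonneg _
  refine ⟨(d ^ 2 + s * (1 + n₀) ^ 2) * (1 + n₀⁻¹) ^ 2, by positivity, fun n => ?_⟩
  have hpos : (0 : ℝ) < n + n₀ := by positivity
  have hn : (0 : ℝ) ≤ n := by positivity
  have hexp : ∫ z : Fin n → Ω, (shrunkMean T x₀ n₀ z - τ) ^ 2 ∂(Measure.pi fun _ => P) =
      (d ^ 2 + n * s) / (n + n₀) ^ 2 := by
    have e : ∀ z : Fin n → Ω, (shrunkMean T x₀ n₀ z - τ) ^ 2 =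
        (d ^ 2 + 2 * d * (∑ i, (T (z i) - τ)) + (∑ i, (T (z i) - τ)) ^ 2) / (n + n₀) ^ 2 := by
      intro z
      rw [shrunkMean_sub T x₀ τ hn₀, div_pow]
      ring
    have i1 : Integrable (fun z : Fin n → Ω => ∑ i, (T (z i) - τ)) (Measure.pi fun _ => P) := by
      simpa using integrable_sum_pow hY n 1 (by norm_num)
    have i2 := integrable_sum_pow hY n 2 le_rfl
    have i3 : Integrable (fun z : Fin n → Ω => d ^ 2 + 2 * d * ∑ i, (T (z i) - τ))
        (Measure.pi fun _ => P) := (integrable_const _).add (i1.const_mul _)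
    simp_rw [e]
    rw [integral_div, integral_add i3 i2,
      integral_add (integrable_const _) (i1.const_mul _), integral_const_mul,
      integral_sum_eq_zero (by simpa using hY 1 (by norm_num)) h0 n, integral_sum_sq hY h0 n]
    simp [hs]
  have key : (d ^ 2 + n * s) / (n + n₀) ^ 2 - s / (n + 1) =
      (d ^ 2 + s * ((n * (n + 1) - (n + n₀) ^ 2) / (n + 1))) / (n + n₀) ^ 2 := by
    field_simp
    ring
  have hb : |((n : ℝ) * (n + 1) - (n + n₀) ^ 2) / (n + 1)| ≤ (1 + n₀) ^ 2 := by
    rw [abs_div, abs_of_pos (by positivity : (0 : ℝ) < n + 1), div_le_iff₀ (by positivity),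
      abs_le]
    have h1 := mul_nonneg hn hn₀.le
    have h2 := mul_nonneg hn (sq_nonneg n₀)
    constructor <;> nlinarith
  rw [hexp, key, abs_div, abs_of_pos (pow_pos hpos 2),
    div_le_div_iff₀ (by positivity) (by positivity)]
  have h1 : |d ^ 2 + s * (((n : ℝ) * (n + 1) - (n + n₀) ^ 2) / (n + 1))| ≤
      d ^ 2 + s * (1 + n₀) ^ 2 := by
    refine (abs_add_le _ _).trans ?_
    rw [abs_mul, abs_of_nonneg hs0, abs_of_nonneg (sq_nonneg d)]
    gcongr
  have hle2 : ((n : ℝ) + 1) ^ 2 ≤ (1 + n₀⁻¹) ^ 2 * (n + n₀) ^ 2 := by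
    rw [← mul_pow]
    exact pow_le_pow_left₀ (by positivity) (add_one_le_mul_add n hn₀) 2
  calc _ ≤ (d ^ 2 + s * (1 + n₀) ^ 2) * ((1 + n₀⁻¹) ^ 2 * (n + n₀) ^ 2) := by gcongr
    _ = _ := by ring

end

end IidMoments

/-! ### Domination of the fourth order Taylor remainder. -/

section RemainderBound

theorem exists_polynomial_eval_le (p : Polynomial ℝ) :
    ∃ A : ℝ, 0 ≤ A ∧ ∃ d : ℕ, ∀ y : ℝ, 0 ≤ y → p.eval y ≤ A * (1 + y) ^ d := by
  refine ⟨∑ i ∈ Finset.range (p.natDegree + 1), |p.coeff i|,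
    Finset.sum_nonneg fun _ _ => abs_nonneg _, p.natDegree, fun y hy => ?_⟩
  rw [Polynomial.eval_eq_sum_range, Finset.sum_mul]
  refine Finset.sum_le_sum fun i hi => ?_
  have h1 : y ^ i ≤ (1 + y) ^ p.natDegree :=
    (pow_le_pow_left₀ hy (by linarith) i).trans
      (pow_le_pow_right₀ (by linarith) (Nat.lt_succ_iff.mp (Finset.mem_range.mp hi)))
  exact mul_le_mul (le_abs_self _) h1 (by positivity) (abs_nonneg _)

theorem exp_le_one_add_add_sq {y : ℝ} (hy : y ≤ 1) : Real.exp y ≤ 1 + y + y ^ 2 := by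
  rcases le_total (-1) y with h | h
  · have := Real.abs_exp_sub_one_sub_id_le (abs_le.mpr ⟨h, hy⟩)
    linarith [(abs_le.mp this).2]
  · have := Real.exp_le_one_iff.mpr (h.trans (by norm_num))
    nlinarith

variable {Ω : Type*} [MeasurableSpace Ω]

/-- A variable with negative mean that is bounded from above has an exponential moment `< 1`. -/
theorem exists_integral_exp_lt_one {P : Measure Ω} [IsProbabilityMeasure P] {W : Ω → ℝ} {b : ℝ}
    (hW : Integrable W P) (hW2 : Integrable (fun x => W x ^ 2) P) (hb : ∀ᵐ x ∂P, W x ≤ b)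
    (hneg : ∫ x, W x ∂P < 0) :
    ∃ t : ℝ, 0 < t ∧ Integrable (fun x => Real.exp (t * W x)) P ∧
      ∫ x, Real.exp (t * W x) ∂P < 1 := by
  set s := ∫ x, W x ^ 2 ∂P with hs
  set e := ∫ x, W x ∂P with he
  have hs0 : 0 ≤ s := integral_nonneg fun x => sq_nonneg _
  -- The first bound on t lets exp y ≤ 1 + y + y² apply to y = t W almost surely, with no lower
  -- bound on W; the second makes the resulting mean 1 + t (e + t s) smaller than 1.
  obtain ⟨t, ht0, htb, hts⟩ : ∃ t : ℝ, 0 < t ∧ t * b ≤ 1 ∧ t * s < -e := by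
    refine ⟨min (1 / (|b| + 1)) (-e / (s + 1)), by
      apply lt_min <;> [positivity; exact div_pos (by linarith) (by linarith)], ?_, ?_⟩
    · calc _ ≤ min (1 / (|b| + 1)) (-e / (s + 1)) * (|b| + 1) := by
            refine mul_le_mul_of_nonneg_left (by linarith [le_abs_self b]) (le_min (by positivity) ?_)
            exact div_nonneg (by linarith) (by linarith)
        _ ≤ 1 / (|b| + 1) * (|b| + 1) := by gcongr; exact min_le_left _ _
        _ = 1 := by field_simp
    · have h1 : min (1 / (|b| + 1)) (-e / (s + 1)) * s ≤ -e / (s + 1) * s := by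
        gcongr; exact min_le_right _ _
      refine h1.trans_lt ?_
      rw [div_mul_eq_mul_div, div_lt_iff₀ (by linarith)]
      nlinarith
  have hle : ∀ᵐ x ∂P, Real.exp (t * W x) ≤ 1 + t * W x + t ^ 2 * W x ^ 2 := by
    filter_upwards [hb] with x hx
    have := exp_le_one_add_add_sq (y := t * W x)
      ((mul_le_mul_of_nonneg_left hx ht0.le).trans htb)
    rwa [mul_pow] at this
  have h1 : Integrable (fun x => 1 + t * W x) P := (integrable_const _).add (hW.const_mul _)
  have h2 : Integrable (fun x => 1 + t * W x + t ^ 2 * W x ^ 2) P := h1.add (hW2.const_mul _)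
  have hint : Integrable (fun x => Real.exp (t * W x)) P := by
    refine h2.mono' (Real.continuous_exp.comp_aestronglyMeasurable
      (hW.aestronglyMeasurable.const_mul t)) ?_
    filter_upwards [hle] with x hx
    rwa [Real.norm_eq_abs, Real.abs_exp]
  refine ⟨t, ht0, hint, ?_⟩
  have h3 := integral_mono_ae hint h2 hle
  rw [integral_add h1 (hW2.const_mul _), integral_add (integrable_const _) (hW.const_mul _),
    integral_const_mul, integral_const_mul, ← hs, ← he] at h3
  simp only [integral_const, probReal_univ, smul_eq_mul, mul_one] at h3
  nlinarith

theorem ae_pi_forall {P : Measure Ω} [IsProbabilityMeasure P] {p : Ω → Prop}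
    (hp : ∀ᵐ x ∂P, p x) (n : ℕ) : ∀ᵐ z : Fin n → Ω ∂(Measure.pi fun _ => P), ∀ i, p (z i) := by
  rw [ae_all_iff]
  intro i
  exact (measurePreserving_eval (fun _ : Fin n => P) i).quasiMeasurePreserving.ae hp

theorem exists_pow_mul_pow_le {ρ : ℝ} (h0 : 0 ≤ ρ) (h1 : ρ < 1) (d : ℕ) :
    ∃ C : ℝ, 0 ≤ C ∧ ∀ n : ℕ, ((n : ℝ) + 1) ^ d * ρ ^ n ≤ C / ((n : ℝ) + 1) ^ 2 := by
  obtain ⟨C, hC⟩ : BddAbove (Set.range fun n : ℕ => (n : ℝ) ^ (d + 2) * ρ ^ n) :=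
    (tendsto_pow_const_mul_const_pow_of_abs_lt_one (d + 2)
      (by rwa [abs_of_nonneg h0])).bddAbove_range
  have hC' : ∀ n : ℕ, (n : ℝ) ^ (d + 2) * ρ ^ n ≤ C := fun n => hC ⟨n, rfl⟩
  have hC0 : 0 ≤ C := le_trans (by positivity) (hC' 0)
  refine ⟨2 ^ (d + 2) * (C + 1), by positivity, fun n => ?_⟩
  rw [le_div_iff₀ (by positivity)]
  have e : ((n : ℝ) + 1) ^ d * ρ ^ n * ((n : ℝ) + 1) ^ 2 = ((n : ℝ) + 1) ^ (d + 2) * ρ ^ n := by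
    ring
  rw [e]
  have hρ : 0 ≤ ρ ^ n := by positivity
  rcases Nat.eq_zero_or_pos n with rfl | hn
  · have : (1 : ℝ) ≤ 2 ^ (d + 2) := one_le_pow₀ (by norm_num)
    simp
    nlinarith
  · have h2 : ((n : ℝ) + 1) ^ (d + 2) ≤ (2 * n) ^ (d + 2) :=
      pow_le_pow_left₀ (by positivity) (by
        have : (1 : ℝ) ≤ n := by exact_mod_cast hn
        linarith) _
    calc _ ≤ (2 * (n : ℝ)) ^ (d + 2) * ρ ^ n := by gcongr
      _ = 2 ^ (d + 2) * ((n : ℝ) ^ (d + 2) * ρ ^ n) := by rw [mul_pow]; ring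
      _ ≤ 2 ^ (d + 2) * (C + 1) := by gcongr; linarith [hC' n]

theorem shrunkMean_le {Ω : Type*} {T : Ω → ℝ} {x₀ n₀ b : ℝ} (hn₀ : 0 < n₀) {n : ℕ} {z : Fin n → Ω}
    (hx₀ : x₀ ≤ b) (hz : ∀ i, T (z i) ≤ b) : shrunkMean T x₀ n₀ z ≤ b := by
  unfold shrunkMean
  rw [div_le_iff₀ (by positivity)]
  have : ∑ i, T (z i) ≤ ∑ _i : Fin n, b := Finset.sum_le_sum fun i _ => hz i
  simp at this
  nlinarith

/-- The weight n₀ / (n + n₀) of the fake outcome keeps the estimator away from g when x₀ < g, so a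
power of 1 / (g - μ̂) grows at most polynomially in n. -/
theorem mul_le_sub_shrunkMean {Ω : Type*} {T : Ω → ℝ} {x₀ n₀ g : ℝ} (hn₀ : 0 < n₀) {n : ℕ} {z : Fin n → Ω}
    (hz : ∀ i, T (z i) ≤ g) : (g - x₀) * n₀ / (n + n₀) ≤ g - shrunkMean T x₀ n₀ z := by
  have hp : 0 < (n : ℝ) + n₀ := by positivity
  unfold shrunkMean
  rw [div_le_iff₀ hp, sub_mul g (_ / _), div_mul_cancel₀ _ hp.ne']
  have : ∑ i, T (z i) ≤ ∑ _i : Fin n, g := Finset.sum_le_sum fun i _ => hz i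
  simp at this
  nlinarith

/-- For n > 0 the estimator is a convex combination, with positive weight on the interior point x₀,
of x₀ and a sample mean in the closure of the convex set Θ; such a point is interior. -/
theorem shrunkMean_mem {Ω : Type*} {Θ : Set ℝ} (ho : IsOpen Θ) (hc : Θ.OrdConnected) {T : Ω → ℝ} {x₀ n₀ : ℝ}
    (hn₀ : 0 < n₀) (hx₀ : x₀ ∈ Θ) {n : ℕ} {z : Fin n → Ω} (hz : ∀ i, T (z i) ∈ closure Θ) :
    shrunkMean T x₀ n₀ z ∈ Θ := by
  rcases Nat.eq_zero_or_pos n with rfl | hn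
  · simpa [shrunkMean, hn₀.ne'] using hx₀
  have hconv : Convex ℝ Θ := hc.convex
  have hn' : (0 : ℝ) < n := by exact_mod_cast hn
  have hmean : (∑ i, (1 / (n : ℝ)) • T (z i)) ∈ closure Θ :=
    hconv.closure.sum_mem (fun _ _ => by positivity) (by simp [hn'.ne']) fun i _ => hz i
  have h := hconv.combo_interior_closure_mem_interior (a := n₀ / (n + n₀)) (b := n / (n + n₀))
    (by rwa [ho.interior_eq]) hmean (by positivity) (by positivity) (by field_simp; ring)
  rw [ho.interior_eq] at h
  convert h using 1
  rw [← Finset.smul_sum]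
  simp only [shrunkMean, smul_eq_mul]
  field_simp

section

variable {P : Measure Ω} [IsProbabilityMeasure P] {T : Ω → ℝ} {k : ℕ} {x₀ τ n₀ : ℝ}

/-- The fourth order remainder `|G ξ| (μ̂ - τ) ^ 4` on the right of `τ` is dominated by functions whose
integrals are `O(1 / n ^ 2)`. -/
def RightRemainderBounded (P : Measure Ω) (T : Ω → ℝ) (x₀ n₀ τ : ℝ) (G : ℝ → ℝ) : Prop :=
  ∃ (B : ∀ n : ℕ, (Fin n → Ω) → ℝ) (C : ℝ),
    (∀ n, Integrable (B n) (Measure.pi fun _ => P)) ∧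
    (∀ n : ℕ, ∫ z, B n z ∂(Measure.pi fun _ => P) ≤ C / ((n : ℝ) + 1) ^ 2) ∧
    (∀ n z, 0 ≤ B n z) ∧
    ∀ n, ∀ᵐ z ∂(Measure.pi fun _ => P), ∀ ξ, τ ≤ ξ → ξ ≤ shrunkMean T x₀ n₀ z →
      |G ξ| * (shrunkMean T x₀ n₀ z - τ) ^ 4 ≤ B n z

/-- Monotonicity replaces ξ by the estimator, leaving its central moments of orders 4 and l + 4.
Evenness of l keeps the dominating function nonnegative also where the estimator lies left of τ. -/
theorem rightRemainderBounded_of_poly {G : ℝ → ℝ} {K : ℝ} {l : ℕ} (hl : Even l)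
    (hT : ∀ j ≤ l + 4, Integrable (fun x => T x ^ j) P) (h0 : ∫ x, (T x - τ) ∂P = 0)
    (hn₀ : 0 < n₀)
    (hK : 0 ≤ K)
    (hG : ∀ n, ∀ᵐ z : Fin n → Ω ∂(Measure.pi fun _ => P), ∀ ξ, τ ≤ ξ →
      ξ ≤ shrunkMean T x₀ n₀ z → |G ξ| ≤ K * (1 + (ξ - τ) ^ l)) :
    RightRemainderBounded P T x₀ n₀ τ G := by
  obtain ⟨C₁, -, hC₁⟩ := exists_abs_integral_shrunkMean_sub_pow_le (x₀ := x₀) hT h0 hn₀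
    (m := 4) (by norm_num) (by omega)
  obtain ⟨C₂, -, hC₂⟩ := exists_abs_integral_shrunkMean_sub_pow_le (x₀ := x₀) hT h0 hn₀
    (m := l + 4) (by omega) le_rfl
  have i1 := fun n => integrable_shrunkMean_sub_pow (x₀ := x₀) (τ := τ) hT hn₀
    (m := 4) (by omega) n
  have i2 := fun n => integrable_shrunkMean_sub_pow (x₀ := x₀) (τ := τ) hT hn₀
    (m := l + 4) (by omega) n
  have hev : Even (l + 4) := hl.add (by decide)
  refine ⟨fun n z => K * ((shrunkMean T x₀ n₀ z - τ) ^ 4 + (shrunkMean T x₀ n₀ z - τ) ^ (l + 4)),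
    K * (C₁ + C₂), fun n => ((i1 n).add (i2 n)).const_mul K, fun n => ?_, fun n z => ?_, fun n => ?_⟩
  · rw [integral_const_mul, integral_add (i1 n) (i2 n), mul_div_assoc, add_div]
    gcongr
    · exact (le_abs_self _).trans (hC₁ n)
    · exact (le_abs_self _).trans (hC₂ n)
  · have := hev.pow_nonneg (shrunkMean T x₀ n₀ z - τ)
    positivity
  · filter_upwards [hG n] with z hz ξ h1 h2
    have h3 : (ξ - τ) ^ l ≤ (shrunkMean T x₀ n₀ z - τ) ^ l :=
      pow_le_pow_left₀ (by linarith) (by linarith) l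
    calc _ ≤ K * (1 + (shrunkMean T x₀ n₀ z - τ) ^ l) * (shrunkMean T x₀ n₀ z - τ) ^ 4 := by
          gcongr
          exact (hz ξ h1 h2).trans (by gcongr)
      _ = _ := by ring

theorem rightRemainderBounded_of_unbounded {Θ : Set ℝ} (hc : Θ.OrdConnected) {f : ℝ → ℝ}
    (hτ : τ ∈ Θ) (hcont : ContinuousOn f Θ) (hn₀ : 0 < n₀)
    (h0 : ∫ x, (T x - τ) ∂P = 0) (hsupp : ∀ᵐ x ∂P, T x ∈ closure Θ)
    (hub : ¬ ∃ g : ℝ, ∀ᵐ x ∂P, T x ≤ g) (hk4 : 4 ≤ k) (hke : Even k)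
    (hT : ∀ j ≤ k, Integrable (fun x => T x ^ j) P)
    (hO : f =O[atTop] (fun μ : ℝ => μ ^ ((k : ℤ) - 6))) :
    RightRemainderBounded P T x₀ n₀ τ f := by
  obtain ⟨C, hC⟩ := hO.bound
  obtain ⟨M₀, hM₀⟩ := eventually_atTop.mp hC
  -- Beyond 2|τ| + 1 one has 1 ≤ ξ ≤ 2 (ξ - τ), which turns powers of ξ into powers of ξ - τ. Below
  -- M compactness suffices.
  set M := max M₀ (2 * |τ| + 1) with hM
  have hM1 : 2 * |τ| + 1 ≤ M := le_max_right _ _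
  have hτM : τ ≤ M := by linarith [le_abs_self τ, abs_nonneg τ]
  obtain ⟨y, hy, hMy⟩ : ∃ y ∈ Θ, M ≤ y := by
    by_contra! h
    refine hub ⟨M, hsupp.mono fun x hx => ?_⟩
    exact closure_minimal (fun y hy => (h y hy).le) isClosed_Iic hx
  have hsub : Set.Icc τ M ⊆ Θ := fun x hx => hc.out hτ hy ⟨hx.1, hx.2.trans hMy⟩
  obtain ⟨K₀, hK₀⟩ := isCompact_Icc.exists_bound_of_continuousOn (hcont.mono hsub)
  have hK₀0 : 0 ≤ K₀ := (norm_nonneg _).trans (hK₀ τ ⟨le_rfl, hτM⟩)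
  have hle : Even (k - 6) := by
    obtain ⟨r, rfl⟩ := hke
    exact ⟨r - 3, by omega⟩
  -- The subtraction is truncated: for k = 4 the exponent -2 is weakened to 0, and four moments are
  -- used. For k ≥ 6 the order k - 2 is within the available moments.
  refine rightRemainderBounded_of_poly (l := k - 6) (K := K₀ + |C| * 2 ^ (k - 6)) hle
    (fun j hj => hT j (by omega)) h0 hn₀ (by positivity) fun n => ae_of_all _ fun z ξ h1 _ => ?_
  have hnn : 0 ≤ (ξ - τ) ^ (k - 6) := hle.pow_nonneg _
  rcases le_total ξ M with h | h
  · calc |f ξ| ≤ K₀ * 1 := by simpa using hK₀ ξ ⟨h1, h⟩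
      _ ≤ _ := by
        gcongr
        · have : 0 ≤ |C| * 2 ^ (k - 6) := by positivity
          linarith
        · linarith
  · have h2 : 2 * |τ| + 1 ≤ ξ := hM1.trans h
    have hξ1 : 1 ≤ ξ := by linarith [abs_nonneg τ]
    have h3 : ξ ^ ((k : ℤ) - 6) ≤ ξ ^ (k - 6) := by
      rw [← zpow_natCast]
      exact zpow_le_zpow_right₀ hξ1 (by omega)
    have h4 : ξ ^ (k - 6) ≤ (2 * (ξ - τ)) ^ (k - 6) :=
      pow_le_pow_left₀ (by linarith) (by linarith [le_abs_self τ]) _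
    have h5 : ‖ξ ^ ((k : ℤ) - 6)‖ ≤ (2 * (ξ - τ)) ^ (k - 6) := by
      rw [Real.norm_of_nonneg (zpow_nonneg (by linarith) _)]
      exact h3.trans h4
    calc |f ξ| ≤ C * ‖ξ ^ ((k : ℤ) - 6)‖ := hM₀ ξ ((le_max_left _ _).trans h)
      _ ≤ |C| * (2 * (ξ - τ)) ^ (k - 6) :=
        mul_le_mul (le_abs_self C) h5 (norm_nonneg _) (abs_nonneg C)
      _ = (0 + |C| * 2 ^ (k - 6)) * (0 + (ξ - τ) ^ (k - 6)) := by rw [mul_pow]; ring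
      _ ≤ _ := by gcongr; norm_num

/-- The estimator never exceeds x₀, so ξ stays in the compact interval [τ, x₀] inside Θ and no
growth condition is needed. -/
theorem rightRemainderBounded_of_le {Θ : Set ℝ} (hc : Θ.OrdConnected) {f : ℝ → ℝ}
    (hτ : τ ∈ Θ) (hx₀ : x₀ ∈ Θ) (hcont : ContinuousOn f Θ) (hn₀ : 0 < n₀)
    (h0 : ∫ x, (T x - τ) ∂P = 0) (hT : ∀ j ≤ 4, Integrable (fun x => T x ^ j) P)
    (hle : ∀ᵐ x ∂P, T x ≤ x₀) :
    RightRemainderBounded P T x₀ n₀ τ f := by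
  obtain ⟨K₀, hK₀⟩ := isCompact_Icc.exists_bound_of_continuousOn (hcont.mono (hc.out hτ hx₀))
  refine rightRemainderBounded_of_poly (l := 0) (K := |K₀|) (by simp) hT h0 hn₀ (abs_nonneg _)
    fun n => ?_
  filter_upwards [ae_pi_forall hle n] with z hz ξ h1 h2
  have h3 := hK₀ ξ ⟨h1, h2.trans (shrunkMean_le hn₀ le_rfl hz)⟩
  rw [Real.norm_eq_abs] at h3
  have := le_abs_self K₀
  have := abs_nonneg K₀
  simp
  linarith

/-- Split at τ + δ in Θ. If the estimator is below it, f is bounded on [τ, τ + δ] and the fourth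
moment is O(n^-2). Above it, f is at most polynomial in n, while a Chernoff bound for T - (τ + δ),
which has mean -δ, contributes ρ^n with ρ < 1. -/
theorem rightRemainderBounded_of_lt {Θ : Set ℝ} (ho : IsOpen Θ) (hc : Θ.OrdConnected) {f : ℝ → ℝ}
    {g : ℝ} {p : Polynomial ℝ}
    (hτ : τ ∈ Θ) (hx₀ : x₀ ∈ Θ) (hcont : ContinuousOn f Θ) (hn₀ : 0 < n₀)
    (h0 : ∫ x, (T x - τ) ∂P = 0) (hT : ∀ j ≤ 4, Integrable (fun x => T x ^ j) P)
    (hsupp : ∀ᵐ x ∂P, T x ∈ closure Θ)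
    (hle : ∀ᵐ x ∂P, T x ≤ g) (hx₀g : x₀ < g)
    (hp : ∀ μ ∈ Θ, τ ≤ μ → μ < g → |f μ| ≤ p.eval (1 / (g - μ))) :
    RightRemainderBounded P T x₀ n₀ τ f := by
  obtain ⟨δ, hδ, hδΘ⟩ : ∃ δ > 0, τ + δ ∈ Θ := by
    obtain ⟨ε, hε, hball⟩ := Metric.isOpen_iff.mp ho τ hτ
    refine ⟨ε / 2, by positivity, hball ?_⟩
    rw [Metric.mem_ball, Real.dist_eq, add_sub_cancel_left, abs_of_pos (by positivity)]
    linarith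
  obtain ⟨K₀, hK₀⟩ := isCompact_Icc.exists_bound_of_continuousOn (hcont.mono (hc.out hτ hδΘ))
  have hK0 : 0 ≤ K₀ := (norm_nonneg _).trans (hK₀ τ ⟨le_rfl, by linarith⟩)
  obtain ⟨A, hA, d, hAd⟩ := exists_polynomial_eval_le p
  have hY := integrable_sub_pow hT (τ + δ)
  have hW1 : Integrable (fun x => T x - (τ + δ)) P := by simpa using hY 1 (by norm_num)
  have hT1 : Integrable T P := by simpa using hT 1 (by norm_num)
  obtain ⟨t, ht0, htint, ht1⟩ := exists_integral_exp_lt_one (b := g - (τ + δ)) hW1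
    (hY 2 (by norm_num)) (hle.mono fun x hx => by linarith) (by
      rw [integral_sub hT1 (integrable_const _)] at h0 ⊢
      simp at h0 ⊢
      linarith)
  set ρ := ∫ x, Real.exp (t * (T x - (τ + δ))) ∂P with hρ
  obtain ⟨C₂, hC₂0, hC₂⟩ := exists_pow_mul_pow_le
    (integral_nonneg fun x => (Real.exp_pos _).le : 0 ≤ ρ) ht1 d
  obtain ⟨C₁, -, hC₁⟩ := exists_abs_integral_shrunkMean_sub_pow_le (x₀ := x₀) hT h0 hn₀
    (m := 4) (by norm_num) le_rfl
  have i1 := fun n => integrable_shrunkMean_sub_pow (x₀ := x₀) (τ := τ) hT hn₀ (m := 4) le_rfl n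
  -- Contribution of the fake outcome to the Chernoff bound: a times the product of the exponentials
  -- is at least 1 whenever the estimator exceeds τ + δ.
  set a := Real.exp (t * ((x₀ - τ) * n₀ - δ * n₀)) with ha
  -- Chosen so that 1 + 1 / (g - ξ) ≤ c (n + 1) for every ξ up to the estimator.
  set c := 1 + (1 + n₀) / ((g - x₀) * n₀) with hcdef
  have hgx : 0 < (g - x₀) * n₀ := mul_pos (by linarith) hn₀
  have hc0 : 0 ≤ c := by positivity
  set Q := A * c ^ d * (g - τ) ^ 4 * a with hQ
  have hQ0 : 0 ≤ Q := by positivity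
  have i2 : ∀ n : ℕ, Integrable (fun z : Fin n → Ω =>
      ∏ i, Real.exp (t * (T (z i) - (τ + δ)))) (Measure.pi fun _ => P) := fun n =>
    Integrable.fintype_prod (f := fun (_ : Fin n) x => Real.exp (t * (T x - (τ + δ))))
      fun _ => htint
  refine ⟨fun n z => K₀ * (shrunkMean T x₀ n₀ z - τ) ^ 4 +
      Q * ((n : ℝ) + 1) ^ d * ∏ i, Real.exp (t * (T (z i) - (τ + δ))), K₀ * C₁ + Q * C₂,
    fun n => ((i1 n).const_mul _).add ((i2 n).const_mul _), fun n => ?_, fun n z => ?_, fun n => ?_⟩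
  · rw [integral_add ((i1 n).const_mul _) ((i2 n).const_mul _), integral_const_mul,
      integral_const_mul, integral_fintype_prod_eq_pow
        (fun x => Real.exp (t * (T x - (τ + δ)))), Fintype.card_fin, add_div, mul_div_assoc,
      mul_div_assoc, mul_assoc Q]
    refine add_le_add (mul_le_mul_of_nonneg_left ((le_abs_self _).trans (hC₁ n)) hK0)
      (mul_le_mul_of_nonneg_left (hC₂ n) hQ0)
  · have : 0 ≤ ∏ i, Real.exp (t * (T (z i) - (τ + δ))) :=
      Finset.prod_nonneg fun _ _ => (Real.exp_pos _).le
    positivity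
  · filter_upwards [ae_pi_forall hle n, ae_pi_forall hsupp n] with z hz hzs ξ h1 h2
    set m := shrunkMean T x₀ n₀ z with hm
    have hmΘ : m ∈ Θ := shrunkMean_mem ho hc hn₀ hx₀ hzs
    have hprod : 0 ≤ ∏ i, Real.exp (t * (T (z i) - (τ + δ))) :=
      Finset.prod_nonneg fun _ _ => (Real.exp_pos _).le
    have hpos : (0 : ℝ) < n + n₀ := by positivity
    rcases le_or_gt m (τ + δ) with h | h
    · have h3 : |f ξ| ≤ K₀ := hK₀ ξ ⟨h1, h2.trans h⟩
      have h4 : |f ξ| * (m - τ) ^ 4 ≤ K₀ * (m - τ) ^ 4 := by gcongr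
      have : 0 ≤ Q * ((n : ℝ) + 1) ^ d * ∏ i, Real.exp (t * (T (z i) - (τ + δ))) := by positivity
      linarith
    · have hgm : (g - x₀) * n₀ / (n + n₀) ≤ g - m := mul_le_sub_shrunkMean hn₀ hz
      have hgm' : 0 < (g - x₀) * n₀ / (n + n₀) := by positivity
      have hgξ : (g - x₀) * n₀ / (n + n₀) ≤ g - ξ := by linarith
      have hinv : 1 / (g - ξ) ≤ (n + n₀) / ((g - x₀) * n₀) := by
        rw [← one_div_div (_ * _)]
        exact one_div_le_one_div_of_le hgm' hgξ
      have hinv0 : 0 ≤ 1 / (g - ξ) := one_div_nonneg.mpr (by linarith)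
      have hbase : 1 + 1 / (g - ξ) ≤ c * (n + 1) := by
        have e1 : ((n : ℝ) + n₀) / ((g - x₀) * n₀) ≤ (1 + n₀) * (n + 1) / ((g - x₀) * n₀) := by
          gcongr
          nlinarith [Nat.cast_nonneg (α := ℝ) n]
        have e2 : c * ((n : ℝ) + 1) = n + 1 + (1 + n₀) * (n + 1) / ((g - x₀) * n₀) := by
          rw [hcdef]; ring
        rw [e2]
        linarith [Nat.cast_nonneg (α := ℝ) n]
      have hf : |f ξ| ≤ A * (c * (n + 1)) ^ d := by
        refine (hp ξ (hc.out hτ hmΘ ⟨h1, h2⟩) h1 (by linarith)).trans ((hAd _ hinv0).trans ?_)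
        gcongr
      have hm4 : (m - τ) ^ 4 ≤ (g - τ) ^ 4 :=
        pow_le_pow_left₀ (by linarith) (by linarith) 4
      have hexp : 1 ≤ a * ∏ i, Real.exp (t * (T (z i) - (τ + δ))) := by
        rw [ha, ← Real.exp_sum, ← Real.exp_add, Real.one_le_exp_iff, ← Finset.mul_sum, ← mul_add]
        refine mul_nonneg ht0.le ?_
        have h5 : δ < m - τ := by linarith
        rw [hm, shrunkMean_sub T x₀ τ hn₀, lt_div_iff₀ hpos] at h5
        simp only [Finset.sum_sub_distrib, Finset.sum_const, Finset.card_univ, Fintype.card_fin,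
          nsmul_eq_mul] at h5 ⊢
        linarith
      have hKm : 0 ≤ K₀ * (m - τ) ^ 4 := by positivity
      calc |f ξ| * (m - τ) ^ 4 ≤ A * (c * (n + 1)) ^ d * (g - τ) ^ 4 * 1 := by
            rw [mul_one]; gcongr
        _ ≤ A * (c * (n + 1)) ^ d * (g - τ) ^ 4 *
            (a * ∏ i, Real.exp (t * (T (z i) - (τ + δ)))) := by gcongr
        _ = Q * ((n : ℝ) + 1) ^ d * ∏ i, Real.exp (t * (T (z i) - (τ + δ))) := by
            rw [hQ, mul_pow]; ring
        _ ≤ _ := by linarith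

theorem rightRemainderBounded_of_tailCondition {Θ : Set ℝ} (ho : IsOpen Θ) (hc : Θ.OrdConnected)
    {f : ℝ → ℝ} (hτ : τ ∈ Θ) (hx₀ : x₀ ∈ Θ) (hcont : ContinuousOn (iteratedDeriv 4 f) Θ)
    (hn₀ : 0 < n₀)
    (h0 : ∫ x, (T x - τ) ∂P = 0) (hT : ∀ j ≤ 4, Integrable (fun x => T x ^ j) P)
    (hsupp : ∀ᵐ x ∂P, T x ∈ closure Θ) (h : ExpFamily.TailCondition P T Θ τ f) :
    RightRemainderBounded P T x₀ n₀ τ (iteratedDeriv 4 f) := by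
  by_cases hub : ∃ g : ℝ, ∀ᵐ x ∂P, T x ≤ g
  · obtain ⟨g, hg, p, hp⟩ := h.2 hub
    -- The bound g constrains T only under P, so x₀ in Θ may lie at or beyond it.
    rcases lt_or_ge x₀ g with hlt | hge
    · exact rightRemainderBounded_of_lt ho hc hτ hx₀ hcont hn₀ h0 hT hsupp hg hlt hp
    · exact rightRemainderBounded_of_le hc hτ hx₀ hcont hn₀ h0 hT
        (hg.mono fun x hx => hx.trans hge)
  · obtain ⟨k, hk4, hke, hTk, hO⟩ := h.1 hub
    exact rightRemainderBounded_of_unbounded hc hτ hcont hn₀ h0 hsupp hub hk4 hke hTk hO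

/-- The moments up to order four exist as soon as the tail condition holds on both sides. -/
theorem integrable_pow_four_of_tailCondition {Θ Θ' : Set ℝ} {τ' : ℝ} {f f' : ℝ → ℝ}
    (hTm : Measurable T)
    (h : ExpFamily.TailCondition P T Θ τ f)
    (h' : ExpFamily.TailCondition P (fun x => -T x) Θ' τ' f') :
    ∀ j ≤ 4, Integrable (fun x => T x ^ j) P := by
  intro j hj
  by_cases hub : ∃ g : ℝ, ∀ᵐ x ∂P, T x ≤ g
  · by_cases hlb : ∃ g : ℝ, ∀ᵐ x ∂P, -T x ≤ g
    · obtain ⟨g, hg⟩ := hub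
      obtain ⟨g', hg'⟩ := hlb
      refine (integrable_const ((max g g') ^ j)).mono' (by fun_prop) ?_
      filter_upwards [hg, hg'] with x h1 h2
      rw [norm_pow, Real.norm_eq_abs]
      exact pow_le_pow_left₀ (abs_nonneg _) (abs_le.mpr
        ⟨by linarith [le_max_right g g'], h1.trans (le_max_left _ _)⟩) _
    · obtain ⟨k, hk4, -, hk, -⟩ := h'.1 hlb
      have := (hk j (hj.trans hk4)).const_mul ((-1) ^ j)
      simpa [← mul_pow] using this
  · obtain ⟨k, hk4, -, hk, -⟩ := h.1 hub
    exact hk j (hj.trans hk4)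

end

end RemainderBound

/-! ### The family as exponential tilting, and its mean value parameterization. -/

namespace ExpFamily

variable {𝒵 : Type*} [MeasurableSpace 𝒵] (F : ExpFamily 𝒵)

/-- The measure with density `h` with respect to the reference measure. -/
noncomputable def carrier : Measure 𝒵 := F.base.withDensity fun z => (F.h z : ℝ≥0∞)

/-- The logarithm of the normalizer. -/
noncomputable def logPartition (η : ℝ) : ℝ := cgf (fun z => -F.X z) F.carrier η

/-- The variance of the statistic in the natural parameterization. -/
noncomputable def varAt (η : ℝ) : ℝ := Var[F.X; F.dist η]

theorem measurable_coe_h : Measurable fun z => (F.h z : ℝ≥0∞) := F.measurable_h.coe_nnreal_ennreal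

theorem partitionFn_eq_lintegral_carrier (η : ℝ) :
    F.partitionFn η = ∫⁻ z, ENNReal.ofReal (Real.exp (η * -F.X z)) ∂F.carrier := by
  have hm : Measurable fun z => ENNReal.ofReal (Real.exp (η * -F.X z)) := by
    have := F.measurable_X
    fun_prop
  rw [carrier, lintegral_withDensity_eq_lintegral_mul _ F.measurable_coe_h hm, partitionFn]
  refine lintegral_congr fun z => ?_
  rw [Pi.mul_apply, ENNReal.ofReal_mul (Real.exp_pos _).le, ENNReal.ofReal_coe_nnreal, mul_comm,
    neg_mul, mul_neg]

theorem naturalSpace_eq_integrableExpSet :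
    F.naturalSpace = integrableExpSet (fun z => -F.X z) F.carrier := by
  ext η
  have hm : AEStronglyMeasurable (fun z => Real.exp (η * -F.X z)) F.carrier := by
    have := F.measurable_X
    exact Measurable.aestronglyMeasurable (by fun_prop)
  rw [naturalSpace, Set.mem_ofPred_eq, partitionFn_eq_lintegral_carrier, integrableExpSet,
    Set.mem_ofPred_eq, Integrable, and_iff_right hm,
    hasFiniteIntegral_iff_ofReal (ae_of_all _ fun z => (Real.exp_pos _).le)]

theorem toReal_partitionFn (η : ℝ) :
    (F.partitionFn η).toReal = mgf (fun z => -F.X z) F.carrier η := by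
  rw [partitionFn_eq_lintegral_carrier, mgf, integral_eq_lintegral_of_nonneg_ae
    (ae_of_all _ fun z => (Real.exp_pos _).le)]
  have := F.measurable_X
  exact Measurable.aestronglyMeasurable (by fun_prop)

/-- Absorbing h into the measure makes the normalizer the moment generating function of -X, so
smoothness, means and variances come from the theory of cumulant generating functions. -/
theorem dist_eq_tilted (η : ℝ) : F.dist η = F.carrier.tilted (fun z => η * -F.X z) := by
  have hm : Measurable fun z =>
      ENNReal.ofReal (Real.exp (η * -F.X z) / ∫ z, Real.exp (η * -F.X z) ∂F.carrier) := by
    have := F.measurable_X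
    fun_prop
  change _ = (F.base.withDensity fun z => (F.h z : ℝ≥0∞)).withDensity fun z =>
    ENNReal.ofReal (Real.exp (η * -F.X z) / ∫ z, Real.exp (η * -F.X z) ∂F.carrier)
  rw [← withDensity_mul _ F.measurable_coe_h hm, dist]
  congr 1
  ext z
  rw [density, toReal_partitionFn, Pi.mul_apply, mul_div_right_comm, mul_comm,
    ENNReal.ofReal_mul (by positivity), ENNReal.ofReal_coe_nnreal, neg_mul, mul_neg]
  rfl

variable {F}

/-- A zero carrier would make every η natural and every M_η the zero measure. -/
theorem carrier_ne_zero (hinj : F.IsIdentifiable) : F.carrier ≠ 0 := by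
  intro h
  have h0 : ∀ η, F.dist η = 0 := fun η => by rw [dist_eq_tilted, h]; simp
  have hN : ∀ η, η ∈ F.naturalSpace := fun η => by
    rw [naturalSpace_eq_integrableExpSet, h, integrableExpSet]
    simp
  exact zero_ne_one (hinj (hN 0) (hN 1) ((h0 0).trans (h0 1).symm))

theorem mem_interior_integrableExpSet (hreg : F.IsRegular) {η : ℝ} (hη : η ∈ F.naturalSpace) :
    η ∈ interior (integrableExpSet (fun z => -F.X z) F.carrier) := by
  rwa [← naturalSpace_eq_integrableExpSet, hreg.1.interior_eq]

theorem integrable_exp {η : ℝ} (hη : η ∈ F.naturalSpace) :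
    Integrable (fun z => Real.exp (η * -F.X z)) F.carrier := by
  rwa [naturalSpace_eq_integrableExpSet] at hη

theorem isProbabilityMeasure_dist (hinj : F.IsIdentifiable) {η : ℝ} (hη : η ∈ F.naturalSpace) :
    IsProbabilityMeasure (F.dist η) := by
  have : NeZero F.carrier := ⟨carrier_ne_zero hinj⟩
  rw [dist_eq_tilted]
  exact isProbabilityMeasure_tilted (integrable_exp hη)

theorem toReal_partitionFn_pos (hinj : F.IsIdentifiable) {η : ℝ} (hη : η ∈ F.naturalSpace) :
    0 < (F.partitionFn η).toReal := by
  rw [toReal_partitionFn]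
  exact mgf_pos' (carrier_ne_zero hinj) (integrable_exp hη)

theorem log_toReal_partitionFn (η : ℝ) :
    Real.log (F.partitionFn η).toReal = F.logPartition η := by
  rw [toReal_partitionFn]
  rfl

theorem memLp_dist (hreg : F.IsRegular) {η : ℝ} (hη : η ∈ F.naturalSpace) (p : ℝ≥0) :
    MemLp F.X p (F.dist η) := by
  rw [dist_eq_tilted]
  simpa [Function.comp_def, Pi.neg_def] using
    (memLp_tilted_mul (mem_interior_integrableExpSet hreg hη) p).neg

theorem mean_eq (hreg : F.IsRegular) {η : ℝ} (hη : η ∈ F.naturalSpace) :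
    F.mean η = -deriv F.logPartition η := by
  have h := integral_tilted_mul_self (mem_interior_integrableExpSet hreg hη)
  rw [← dist_eq_tilted, integral_neg] at h
  unfold logPartition
  rw [mean]
  linarith

theorem varAt_eq (hreg : F.IsRegular) {η : ℝ} (hη : η ∈ F.naturalSpace) :
    F.varAt η = iteratedDeriv 2 F.logPartition η := by
  have h := variance_tilted_mul (mem_interior_integrableExpSet hreg hη)
  rw [← dist_eq_tilted] at h
  rw [varAt, ← variance_neg]
  exact h

theorem analyticAt_logPartition (hreg : F.IsRegular) {η : ℝ} (hη : η ∈ F.naturalSpace) :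
    AnalyticAt ℝ F.logPartition η :=
  analyticAt_cgf (mem_interior_integrableExpSet hreg hη)

theorem dist_tilted_sub {η η' : ℝ} (hη : η ∈ F.naturalSpace) :
    (F.dist η).tilted (fun z => (η' - η) * -F.X z) = F.dist η' := by
  rw [dist_eq_tilted, tilted_tilted (integrable_exp hη), dist_eq_tilted]
  congr 1
  ext z
  simp only [Pi.add_apply]
  ring

/-- With zero variance X is almost surely constant, so tilting to a nearby parameter, available by
openness, does not change the distribution; this contradicts identifiability. -/
theorem varAt_pos (hreg : F.IsRegular) (hinj : F.IsIdentifiable) {η : ℝ}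
    (hη : η ∈ F.naturalSpace) : 0 < F.varAt η := by
  have := isProbabilityMeasure_dist hinj hη
  refine lt_of_le_of_ne (variance_nonneg _ _) fun h => ?_
  have hae := ae_eq_integral_of_variance_eq_zero (memLp_dist hreg hη 2) h.symm
  obtain ⟨ε, hε, hball⟩ := Metric.isOpen_iff.mp hreg.1 η hη
  have hη' : η + ε / 2 ∈ F.naturalSpace := hball (by
    rw [Metric.mem_ball, Real.dist_eq, add_sub_cancel_left, abs_of_pos (by positivity)]
    linarith)
  have heq : F.dist (η + ε / 2) = F.dist η := by
    rw [← dist_tilted_sub hη]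
    rw [tilted_congr (g := fun _ => (η + ε / 2 - η) * -∫ z, F.X z ∂F.dist η)]
    · exact tilted_const _ _
    · filter_upwards [hae] with z hz
      rw [hz]
  have := hinj hη' hη heq
  linarith

theorem contDiffAt_mean (hreg : F.IsRegular) {η : ℝ} (hη : η ∈ F.naturalSpace) (n : ℕ) :
    ContDiffAt ℝ n F.mean η := by
  have h : ContDiffAt ℝ n (fun η => -deriv F.logPartition η) η :=
    (analyticAt_logPartition hreg hη).deriv.contDiffAt.neg
  refine h.congr_of_eventuallyEq ?_
  filter_upwards [hreg.1.mem_nhds hη] with x hx using mean_eq hreg hx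

theorem hasStrictDerivAt_mean (hreg : F.IsRegular) {η : ℝ} (hη : η ∈ F.naturalSpace) :
    HasStrictDerivAt F.mean (-F.varAt η) η := by
  have h := (contDiffAt_mean hreg hη 1).hasStrictDerivAt (by norm_num)
  have he : F.mean =ᶠ[𝓝 η] fun η => -deriv F.logPartition η := by
    filter_upwards [hreg.1.mem_nhds hη] with x hx using mean_eq hreg hx
  have hv : deriv (deriv F.logPartition) η = F.varAt η := by
    rw [varAt_eq hreg hη, iteratedDeriv_succ, iteratedDeriv_one]
  rwa [he.deriv_eq, deriv.fun_neg, hv] at h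

theorem strictAntiOn_mean (hreg : F.IsRegular) (hinj : F.IsIdentifiable) :
    StrictAntiOn F.mean F.naturalSpace := by
  refine strictAntiOn_of_deriv_neg hreg.2.convex
    (fun η hη => (contDiffAt_mean hreg hη 0).continuousAt.continuousWithinAt) fun η hη => ?_
  have hη' := interior_subset hη
  rw [(hasStrictDerivAt_mean hreg hη').hasDerivAt.deriv]
  linarith [varAt_pos hreg hinj hη']

theorem natParam_mem {μ : ℝ} (hμ : μ ∈ F.meanSpace) : F.natParam μ ∈ F.naturalSpace :=
  Function.invFunOn_mem hμ

theorem mean_natParam {μ : ℝ} (hμ : μ ∈ F.meanSpace) : F.mean (F.natParam μ) = μ :=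
  Function.invFunOn_eq hμ

theorem natParam_mean (hreg : F.IsRegular) (hinj : F.IsIdentifiable) {η : ℝ}
    (hη : η ∈ F.naturalSpace) : F.natParam (F.mean η) = η :=
  (strictAntiOn_mean hreg hinj).injOn (natParam_mem ⟨η, hη, rfl⟩) hη (mean_natParam ⟨η, hη, rfl⟩)

theorem isOpen_meanSpace (hreg : F.IsRegular) (hinj : F.IsIdentifiable) : IsOpen F.meanSpace := by
  rw [isOpen_iff_mem_nhds]
  rintro _ ⟨η, hη, rfl⟩
  rw [← (hasStrictDerivAt_mean hreg hη).map_nhds_eq (neg_ne_zero.mpr (varAt_pos hreg hinj hη).ne')]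
  exact image_mem_map (hreg.1.mem_nhds hη)

theorem ordConnected_meanSpace (hreg : F.IsRegular) : F.meanSpace.OrdConnected := by
  refine IsPreconnected.ordConnected (IsPreconnected.image hreg.2.isPreconnected _ ?_)
  exact fun η hη => (contDiffAt_mean hreg hη 0).continuousAt.continuousWithinAt

theorem eventually_natParam_mean (hreg : F.IsRegular) (hinj : F.IsIdentifiable) {η : ℝ}
    (hη : η ∈ F.naturalSpace) : ∀ᶠ x in 𝓝 η, F.natParam (F.mean x) = x := by
  filter_upwards [hreg.1.mem_nhds hη] with x hx using natParam_mean hreg hinj hx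

theorem hasDerivAt_natParam (hreg : F.IsRegular) (hinj : F.IsIdentifiable) {μ : ℝ}
    (hμ : μ ∈ F.meanSpace) : HasDerivAt F.natParam (-(F.varAt (F.natParam μ))⁻¹) μ := by
  have hη := natParam_mem hμ
  have h := (hasStrictDerivAt_mean hreg hη).to_local_left_inverse
    (neg_ne_zero.mpr (varAt_pos hreg hinj hη).ne') (eventually_natParam_mean hreg hinj hη)
  rw [mean_natParam hμ, inv_neg] at h
  exact h.hasDerivAt

theorem contDiffAt_natParam (hreg : F.IsRegular) (hinj : F.IsIdentifiable) {μ : ℝ}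
    (hμ : μ ∈ F.meanSpace) (n : ℕ) : ContDiffAt ℝ n F.natParam μ := by
  have hη := natParam_mem hμ
  -- One extra order, because the inverse function theorem needs a nonzero order and n may be 0.
  have hc := contDiffAt_mean hreg hη (n + 1)
  have hne : -F.varAt (F.natParam μ) ≠ 0 := neg_ne_zero.mpr (varAt_pos hreg hinj hη).ne'
  have hd := (hasStrictDerivAt_mean hreg hη).hasStrictFDerivAt_equiv hne
  have hn : ((n + 1 : ℕ) : WithTop ℕ∞) ≠ 0 := by simp
  have h := hc.to_localInverse hd.hasFDerivAt hn
  have he := (hc.hasStrictFDerivAt' hd.hasFDerivAt hn).localInverse_unique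
    (eventually_natParam_mean hreg hinj hη)
  have h2 := h.congr_of_eventuallyEq he
  rw [mean_natParam hμ] at h2
  exact h2.of_le (by exact_mod_cast Nat.le_succ n)

/-! ### Divergence as a function of the mean. -/

theorem divergence_eq (hreg : F.IsRegular) (hinj : F.IsIdentifiable) {μ' μ : ℝ}
    (hμ' : μ' ∈ F.meanSpace) (hμ : μ ∈ F.meanSpace) :
    F.divergence μ' μ = (F.natParam μ - F.natParam μ') * μ' +
      (F.logPartition (F.natParam μ) - F.logPartition (F.natParam μ')) := by
  have hη' := natParam_mem hμ'
  have hη := natParam_mem hμ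
  set η' := F.natParam μ'
  set η := F.natParam μ
  have hp' := isProbabilityMeasure_dist hinj hη'
  have hp := isProbabilityMeasure_dist hinj hη
  have hX : Integrable F.X (F.dist η') := (memLp_dist hreg hη' 1).integrable le_rfl
  have hf : Integrable (fun z => (η - η') * -F.X z) (F.dist η') := hX.neg.const_mul _
  have hadd : ∀ z, η' * -F.X z + (η - η') * -F.X z = η * -F.X z := fun z => by ring
  have hexp : Integrable (fun z => Real.exp ((η - η') * -F.X z)) (F.dist η') := by
    rw [dist_eq_tilted, integrable_tilted_iff (integrable_exp hη')]
    simpa only [smul_eq_mul, ← Real.exp_add, hadd] using integrable_exp hη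
  have hllr : llr (F.dist η') (F.dist η') =ᵐ[F.dist η'] 0 := llr_self _
  have hint : Integrable (llr (F.dist η') (F.dist η')) (F.dist η') :=
    (integrable_congr hllr).mpr (integrable_zero _ _ _)
  -- M_η is a tilt of M_η', so the log-likelihood ratio is affine in X and only the mean μ' enters.
  -- Equal total masses remove the correction term of `klDiv`.
  rw [divergence, meanDist, meanDist,
    InformationTheory.toReal_klDiv_of_measure_eq ?_ (by simp [η, η'])]
  · change ∫ a, llr (F.dist η') (F.dist η) a ∂F.dist η' = _
    rw [← dist_tilted_sub (η' := η) hη', integral_llr_tilted_right Measure.AbsolutelyContinuous.rfl hf hexp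
      hint, integral_congr_ae hllr, integral_const_mul, integral_neg]
    have hm : ∫ z, F.X z ∂F.dist η' = μ' := mean_natParam hμ'
    have hl : Real.log (∫ z, Real.exp ((η - η') * -F.X z) ∂F.dist η') =
        F.logPartition η - F.logPartition η' := by
      have hq : ∫ z, Real.exp ((η - η') * -F.X z) ∂F.dist η' =
          (F.partitionFn η).toReal / (F.partitionFn η').toReal := by
        rw [dist_eq_tilted, integral_exp_tilted, toReal_partitionFn, toReal_partitionFn, mgf, mgf]
        congr 1
        refine integral_congr_ae (ae_of_all _ fun z => ?_)
        exact congrArg Real.exp (hadd z)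
      rw [hq, Real.log_div (toReal_partitionFn_pos hinj hη).ne'
        (toReal_partitionFn_pos hinj hη').ne', log_toReal_partitionFn, log_toReal_partitionFn]
    rw [hm, hl]
    simp
  · change F.dist η' ≪ F.dist η
    rw [← dist_tilted_sub (η' := η) hη']
    exact absolutelyContinuous_tilted hexp

theorem divergence_nonneg (μ' μ : ℝ) : 0 ≤ F.divergence μ' μ := ENNReal.toReal_nonneg

theorem divergence_self (hreg : F.IsRegular) (hinj : F.IsIdentifiable) {μ : ℝ}
    (hμ : μ ∈ F.meanSpace) : F.divergence μ μ = 0 := by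
  simp [divergence_eq hreg hinj hμ hμ]

theorem contDiffAt_logPartition_natParam (hreg : F.IsRegular) (hinj : F.IsIdentifiable) {μ : ℝ}
    (hμ : μ ∈ F.meanSpace) (n : ℕ) : ContDiffAt ℝ n (fun μ => F.logPartition (F.natParam μ)) μ :=
  (analyticAt_logPartition hreg (natParam_mem hμ)).contDiffAt.comp μ
    (contDiffAt_natParam hreg hinj hμ n)

theorem divergence_eventuallyEq (hreg : F.IsRegular) (hinj : F.IsIdentifiable) {μs μ : ℝ}
    (hμs : μs ∈ F.meanSpace) (hμ : μ ∈ F.meanSpace) :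
    F.divergence μs =ᶠ[𝓝 μ] fun μ => (F.natParam μ - F.natParam μs) * μs +
      (F.logPartition (F.natParam μ) - F.logPartition (F.natParam μs)) := by
  filter_upwards [(isOpen_meanSpace hreg hinj).mem_nhds hμ] with x hx
  exact divergence_eq hreg hinj hμs hx

theorem contDiffAt_divergence (hreg : F.IsRegular) (hinj : F.IsIdentifiable) {μs μ : ℝ}
    (hμs : μs ∈ F.meanSpace) (hμ : μ ∈ F.meanSpace) (n : ℕ) :
    ContDiffAt ℝ n (F.divergence μs) μ :=
  ((((contDiffAt_natParam hreg hinj hμ n).sub contDiffAt_const).mul contDiffAt_const).add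
    ((contDiffAt_logPartition_natParam hreg hinj hμ n).sub contDiffAt_const)).congr_of_eventuallyEq
    (divergence_eventuallyEq hreg hinj hμs hμ)

/-- The log normalizer has slope -μ at the natural parameter of μ, so the chain rule leaves the
factor μs - μ. At μs it vanishes, which is why the second derivative there involves only the first
derivative of `natParam`. -/
theorem hasDerivAt_divergence (hreg : F.IsRegular) (hinj : F.IsIdentifiable) {μs μ : ℝ}
    (hμs : μs ∈ F.meanSpace) (hμ : μ ∈ F.meanSpace) :
    HasDerivAt (F.divergence μs) ((μs - μ) * deriv F.natParam μ) μ := by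
  have h1 := hasDerivAt_natParam hreg hinj hμ
  have h2 : HasDerivAt F.logPartition (-μ) (F.natParam μ) := by
    have := (analyticAt_logPartition hreg (natParam_mem hμ)).differentiableAt.hasDerivAt
    have hm := mean_eq hreg (natParam_mem hμ)
    rw [mean_natParam hμ] at hm
    exact this.congr_deriv (by linarith)
  have h3 := ((h1.sub_const (F.natParam μs)).mul_const μs).add
    ((h2.comp μ h1).sub_const (F.logPartition (F.natParam μs)))
  refine (h3.congr_of_eventuallyEq (divergence_eventuallyEq hreg hinj hμs hμ)).congr_deriv ?_
  rw [h1.deriv]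
  ring

theorem iteratedDeriv_two_divergence (hreg : F.IsRegular) (hinj : F.IsIdentifiable) {μs : ℝ}
    (hμs : μs ∈ F.meanSpace) :
    iteratedDeriv 2 (F.divergence μs) μs = (F.varAt (F.natParam μs))⁻¹ := by
  have he : deriv (F.divergence μs) =ᶠ[𝓝 μs] fun μ => (μs - μ) * deriv F.natParam μ := by
    filter_upwards [(isOpen_meanSpace hreg hinj).mem_nhds hμs] with x hx
    exact (hasDerivAt_divergence hreg hinj hμs hx).deriv
  have hd : DifferentiableAt ℝ (deriv F.natParam) μs :=
    ((contDiffAt_natParam hreg hinj hμs 2).derivWithin (m := 1) (by norm_num)).differentiableAt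
      one_ne_zero
  have h := ((hasDerivAt_id μs).const_sub μs).mul hd.hasDerivAt
  rw [iteratedDeriv_succ, iteratedDeriv_one, he.deriv_eq]
  refine h.deriv.trans ?_
  rw [(hasDerivAt_natParam hreg hinj hμs).deriv]
  simp

/-- The natural parameter grows at most linearly in the divergence. -/
theorem exists_abs_natParam_sub_le (hreg : F.IsRegular) (hinj : F.IsIdentifiable) {μs : ℝ}
    (hμs : μs ∈ F.meanSpace) :
    ∃ C D : ℝ, ∀ μ ∈ F.meanSpace,
      |F.natParam μ - F.natParam μs| ≤ C + D * F.divergence μs μ := by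
  obtain ⟨ε, hε, hball⟩ := Metric.isOpen_iff.mp (isOpen_meanSpace hreg hinj) μs hμs
  set δ := ε / 2 with hδ
  have hδ0 : 0 < δ := by positivity
  have h1 : μs + δ ∈ F.meanSpace := hball (by
    rw [Metric.mem_ball, Real.dist_eq, add_sub_cancel_left, abs_of_pos hδ0]
    linarith)
  have h2 : μs - δ ∈ F.meanSpace := hball (by
    rw [Metric.mem_ball, Real.dist_eq, sub_sub_cancel_left, abs_neg, abs_of_pos hδ0]
    linarith)
  -- The difference of the divergences from μs and from μ₁ is affine in the natural parameter with
  -- slope μs - μ₁, and the divergence from μ₁ is nonnegative. Taking μ₁ on both sides of μs bounds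
  -- both signs.
  have key : ∀ μ₁ ∈ F.meanSpace, ∃ c, ∀ μ ∈ F.meanSpace,
      (F.natParam μ - F.natParam μs) * (μs - μ₁) ≤ c + F.divergence μs μ := by
    intro μ₁ hμ₁
    refine ⟨-((F.natParam μ₁ - F.natParam μs) * μ₁ +
      (F.logPartition (F.natParam μ₁) - F.logPartition (F.natParam μs))), fun μ hμ => ?_⟩
    have h3 := divergence_nonneg (F := F) μ₁ μ
    rw [divergence_eq hreg hinj hμ₁ hμ] at h3
    rw [divergence_eq hreg hinj hμs hμ]
    linarith
  obtain ⟨c₁, hc₁⟩ := key _ h1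
  obtain ⟨c₂, hc₂⟩ := key _ h2
  refine ⟨max c₁ c₂ / δ, 1 / δ, fun μ hμ => ?_⟩
  have h3 := hc₁ μ hμ
  have h4 := hc₂ μ hμ
  rw [← sub_nonneg]
  have : |F.natParam μ - F.natParam μs| * δ ≤ max c₁ c₂ + F.divergence μs μ := by
    nth_rewrite 1 [← abs_of_pos hδ0]
    rw [← abs_mul]
    refine abs_le.mpr ⟨?_, ?_⟩
    · linarith [le_max_left c₁ c₂]
    · linarith [le_max_right c₁ c₂]
  have h5 := (le_div_iff₀ hδ0).mpr this
  rw [add_div] at h5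
  rw [one_div_mul_eq_div]
  linarith

/-- The fourth order Taylor expansion of the divergence. -/
theorem exists_divergence_eq_taylor (hreg : F.IsRegular) (hinj : F.IsIdentifiable) {μs : ℝ}
    (hμs : μs ∈ F.meanSpace) :
    ∃ b : ℝ, ∀ μ ∈ F.meanSpace, ∃ ξ ∈ Set.uIcc μs μ,
      F.divergence μs μ = (F.varAt (F.natParam μs))⁻¹ / 2 * (μ - μs) ^ 2 + b * (μ - μs) ^ 3 +
        iteratedDeriv 4 (F.divergence μs) ξ * (μ - μs) ^ 4 / 24 := by
  refine ⟨iteratedDeriv 3 (F.divergence μs) μs / 6, fun μ hμ => ?_⟩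
  rcases eq_or_ne μs μ with rfl | hne
  · exact ⟨μs, by simp, by simp [divergence_self hreg hinj hμ]⟩
  have hsub : Set.uIcc μs μ ⊆ F.meanSpace := (ordConnected_meanSpace hreg).uIcc_subset hμs hμ
  obtain ⟨ξ, hξ, h⟩ := taylor_mean_remainder_lagrange_iteratedDeriv (n := 3) hne
    (f := F.divergence μs)
    (fun x hx => (contDiffAt_divergence hreg hinj hμs (hsub hx) 4).contDiffWithinAt)
  refine ⟨ξ, Set.Ioo_subset_Icc_self hξ, ?_⟩
  have hw : ∀ n : ℕ, iteratedDerivWithin n (F.divergence μs) (Set.uIcc μs μ) μs =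
      iteratedDeriv n (F.divergence μs) μs := fun n =>
    iteratedDerivWithin_eq_iteratedDeriv (uniqueDiffOn_uIcc hne)
      (contDiffAt_divergence hreg hinj hμs hμs n) Set.left_mem_uIcc
  simp only [taylorWithinEval_succ, taylor_within_zero_eval, hw, iteratedDeriv_two_divergence hreg
    hinj hμs, divergence_self hreg hinj hμs] at h
  norm_num [Nat.factorial, (hasDerivAt_divergence hreg hinj hμs hμs).deriv] at h
  linarith

end ExpFamily

/-! ### Expected divergence of the estimator. -/

namespace ExpFamily

variable {𝒵 : Type*} [MeasurableSpace 𝒵] {F : ExpFamily 𝒵}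

theorem continuousOn_iteratedDeriv_divergence (hreg : F.IsRegular) (hinj : F.IsIdentifiable)
    {μs : ℝ} (hμs : μs ∈ F.meanSpace) (n : ℕ) :
    ContinuousOn (iteratedDeriv n (F.divergence μs)) F.meanSpace := by
  have ho := isOpen_meanSpace hreg hinj
  have h : ContDiffOn ℝ n (F.divergence μs) F.meanSpace := fun μ hμ =>
    (contDiffAt_divergence hreg hinj hμs hμ n).contDiffWithinAt
  exact (h.continuousOn_iteratedDerivWithin le_rfl ho.uniqueDiffOn).congr fun μ hμ =>
    (iteratedDerivWithin_of_isOpen ho hμ).symm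

section

variable {P : Measure 𝒵} [IsProbabilityMeasure P] {μs x₀ n₀ : ℝ}

theorem ae_estimator_mem (hreg : F.IsRegular) (hinj : F.IsIdentifiable)
    (hsupp : ∀ᵐ z ∂P, F.X z ∈ closure F.meanSpace) (hx₀ : x₀ ∈ F.meanSpace) (hn₀ : 0 < n₀)
    (n : ℕ) : ∀ᵐ z : Fin n → 𝒵 ∂(Measure.pi fun _ => P),
      F.estimator x₀ n₀ z ∈ F.meanSpace := by
  filter_upwards [ae_pi_forall hsupp n] with z hz
  exact shrunkMean_mem (isOpen_meanSpace hreg hinj) (ordConnected_meanSpace hreg) hn₀ hx₀ hz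

/-- Outside the mean space nothing is known about g, so it is replaced there by 0; almost surely the
estimator does not see the change. -/
theorem aestronglyMeasurable_comp_estimator (hreg : F.IsRegular) (hinj : F.IsIdentifiable)
    (hsupp : ∀ᵐ z ∂P, F.X z ∈ closure F.meanSpace) (hx₀ : x₀ ∈ F.meanSpace) (hn₀ : 0 < n₀)
    {g : ℝ → ℝ} (hg : ContinuousOn g F.meanSpace) (n : ℕ) :
    AEStronglyMeasurable (fun z : Fin n → 𝒵 => g (F.estimator x₀ n₀ z))
      (Measure.pi fun _ => P) := by
  classical
  have hm : Measurable (F.meanSpace.piecewise g 0) :=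
    hg.measurable_piecewise continuousOn_const (isOpen_meanSpace hreg hinj).measurableSet
  refine ((hm.comp (measurable_shrunkMean F.measurable_X x₀ n₀ n)).aestronglyMeasurable).congr ?_
  filter_upwards [ae_estimator_mem hreg hinj hsupp hx₀ hn₀ n] with z hz
  exact Set.piecewise_eq_of_mem _ _ _ hz

/-- The expected divergence of the estimator is its second order approximation up to
`O(1 / n ^ 2)`. -/
theorem integrable_divergence_estimator (hreg : F.IsRegular) (hinj : F.IsIdentifiable)
    (hμs : μs ∈ F.meanSpace) (hint : Integrable F.X P) (hmean : ∫ z, F.X z ∂P = μs)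
    (hsupp : ∀ᵐ z ∂P, F.X z ∈ closure F.meanSpace) (hx₀ : x₀ ∈ F.meanSpace) (hn₀ : 0 < n₀)
    (hcond : F.GrowthCondition P μs) :
    (∀ n, Integrable (fun z : Fin n → 𝒵 => F.divergence μs (F.estimator x₀ n₀ z))
      (Measure.pi fun _ => P)) ∧
    ∃ C : ℝ, ∀ n : ℕ,
      |∫ z : Fin n → 𝒵, F.divergence μs (F.estimator x₀ n₀ z) ∂(Measure.pi fun _ => P) -
        (F.varAt (F.natParam μs))⁻¹ / 2 * (∫ z, (F.X z - μs) ^ 2 ∂P) / (n + 1)| ≤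
      C / ((n : ℝ) + 1) ^ 2 := by
  have ho := isOpen_meanSpace hreg hinj
  have hoc := ordConnected_meanSpace hreg
  have hT := integrable_pow_four_of_tailCondition F.measurable_X hcond.1 hcond.2
  have h0 : ∫ z, (F.X z - μs) ∂P = 0 := by
    rw [integral_sub hint (integrable_const _), hmean]
    simp
  have hcont := continuousOn_iteratedDeriv_divergence hreg hinj hμs 4
  have h4neg : ∀ x, iteratedDeriv 4 (fun μ => F.divergence μs (-μ)) x =
      iteratedDeriv 4 (F.divergence μs) (-x) := fun x => by
    rw [iteratedDeriv_comp_neg]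
    norm_num
  obtain ⟨Bp, Cp, hBp, hCp, hBp0, hBpl⟩ := rightRemainderBounded_of_tailCondition ho hoc hμs hx₀
    hcont hn₀ h0 hT hsupp hcond.1
  -- The left side of μs is the right side for -X with fake outcome -x₀, whose estimator is the
  -- negative of the original. The even order of the derivative leaves no sign.
  obtain ⟨Bm, Cm, hBm, hCm, hBm0, hBml⟩ := rightRemainderBounded_of_tailCondition (x₀ := -x₀)
    (Θ := {μ | -μ ∈ F.meanSpace}) (ho.preimage continuous_neg)
    ⟨fun a ha b hb x hx => hoc.out hb ha ⟨neg_le_neg hx.2, neg_le_neg hx.1⟩⟩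
    (by simpa using hμs) (by simpa using hx₀)
    (by
      simp_rw [funext h4neg]
      exact hcont.comp continuous_neg.continuousOn fun x hx => hx)
    hn₀ (by simpa [neg_add_eq_sub, ← integral_neg] using congrArg Neg.neg h0)
    (fun j hj => by simpa [← mul_pow] using (hT j hj).const_mul ((-1) ^ j))
    (hsupp.mono fun z hz => map_mem_closure continuous_neg hz fun x hx => by simpa using hx)
    hcond.2
  obtain ⟨b, hb⟩ := exists_divergence_eq_taylor hreg hinj hμs
  set a := (F.varAt (F.natParam μs))⁻¹ / 2 with ha
  obtain ⟨C₂, -, hC₂⟩ := exists_abs_integral_shrunkMean_sub_sq_le (x₀ := x₀)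
    (fun j hj => hT j (by omega)) h0 hn₀
  obtain ⟨C₃, -, hC₃⟩ := exists_abs_integral_shrunkMean_sub_pow_le (x₀ := x₀) hT h0 hn₀
    (m := 3) le_rfl (by norm_num)
  have i2 := fun n => integrable_shrunkMean_sub_pow (x₀ := x₀) (τ := μs) hT hn₀
    (m := 2) (by norm_num) n
  have i3 := fun n => integrable_shrunkMean_sub_pow (x₀ := x₀) (τ := μs) hT hn₀
    (m := 3) (by norm_num) n
  have i23 : ∀ n : ℕ, Integrable (fun z : Fin n → 𝒵 => a * (F.estimator x₀ n₀ z - μs) ^ 2 +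
      b * (F.estimator x₀ n₀ z - μs) ^ 3) (Measure.pi fun _ => P) := fun n =>
    ((i2 n).const_mul a).add ((i3 n).const_mul b)
  -- The Taylor point ξ depends on z with no known measurability; the dominating functions hold for
  -- all admissible ξ, so it never enters an integral.
  have hrem : ∀ n : ℕ, ∀ᵐ z : Fin n → 𝒵 ∂(Measure.pi fun _ => P),
      |F.divergence μs (F.estimator x₀ n₀ z) - (a * (F.estimator x₀ n₀ z - μs) ^ 2 +
        b * (F.estimator x₀ n₀ z - μs) ^ 3)| ≤ Bp n z + Bm n z := by
    intro n
    filter_upwards [ae_estimator_mem hreg hinj hsupp hx₀ hn₀ n, hBpl n, hBml n] with z hz hp hm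
    obtain ⟨ξ, hξ, he⟩ := hb _ hz
    have hneg : shrunkMean (fun z => -F.X z) (-x₀) n₀ z = -F.estimator x₀ n₀ z := by
      simp only [shrunkMean, estimator, Finset.sum_neg_distrib]
      ring
    rw [he, add_sub_cancel_left, abs_div, abs_mul, abs_of_nonneg
      (by positivity : 0 ≤ (F.estimator x₀ n₀ z - μs) ^ 4),
      abs_of_pos (by norm_num : (0 : ℝ) < 24)]
    have hnn : 0 ≤ |iteratedDeriv 4 (F.divergence μs) ξ| * (F.estimator x₀ n₀ z - μs) ^ 4 := by
      positivity
    have h1 := hBp0 n z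
    have h2 := hBm0 n z
    rcases le_total μs (F.estimator x₀ n₀ z) with h | h
    · rw [Set.uIcc_of_le h] at hξ
      have : |iteratedDeriv 4 (F.divergence μs) ξ| * (F.estimator x₀ n₀ z - μs) ^ 4 ≤ Bp n z :=
        hp ξ hξ.1 hξ.2
      linarith
    · rw [Set.uIcc_of_ge h] at hξ
      have h5 := hm (-ξ) (neg_le_neg hξ.2) (by rw [hneg]; exact neg_le_neg hξ.1)
      rw [hneg, h4neg, neg_neg] at h5
      have e4 : (-F.estimator x₀ n₀ z - -μs) ^ 4 = (F.estimator x₀ n₀ z - μs) ^ 4 := by ring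
      rw [e4] at h5
      linarith
  have irem : ∀ n : ℕ, Integrable (fun z : Fin n → 𝒵 =>
      F.divergence μs (F.estimator x₀ n₀ z) - (a * (F.estimator x₀ n₀ z - μs) ^ 2 +
        b * (F.estimator x₀ n₀ z - μs) ^ 3)) (Measure.pi fun _ => P) := by
    intro n
    refine ((hBp n).add (hBm n)).mono' ?_ (hrem n)
    refine (aestronglyMeasurable_comp_estimator hreg hinj hsupp hx₀ hn₀ ?_ n).sub
      (i23 n).aestronglyMeasurable
    exact fun μ hμ => (contDiffAt_divergence hreg hinj hμs hμ 0).continuousAt.continuousWithinAt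
  refine ⟨fun n => ((irem n).add (i23 n)).congr (ae_of_all _ fun z => sub_add_cancel _ _),
    |a| * C₂ + |b| * C₃ + (Cp + Cm), fun n => ?_⟩
  have e1 : ∫ z : Fin n → 𝒵, F.divergence μs (F.estimator x₀ n₀ z) ∂(Measure.pi fun _ => P) =
      (∫ z : Fin n → 𝒵, (F.divergence μs (F.estimator x₀ n₀ z) -
        (a * (F.estimator x₀ n₀ z - μs) ^ 2 + b * (F.estimator x₀ n₀ z - μs) ^ 3))
        ∂(Measure.pi fun _ => P)) +
      (a * (∫ z : Fin n → 𝒵, (shrunkMean F.X x₀ n₀ z - μs) ^ 2 ∂(Measure.pi fun _ => P)) +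
       b * (∫ z : Fin n → 𝒵, (shrunkMean F.X x₀ n₀ z - μs) ^ 3 ∂(Measure.pi fun _ => P))) := by
    rw [← integral_const_mul, ← integral_const_mul,
      ← integral_add ((i2 n).const_mul a) ((i3 n).const_mul b)]
    refine Eq.trans ?_ (integral_add (irem n) (i23 n))
    exact integral_congr_ae (ae_of_all _ fun z => (sub_add_cancel _ _).symm)
  have hr : |∫ z : Fin n → 𝒵, (F.divergence μs (F.estimator x₀ n₀ z) -
        (a * (F.estimator x₀ n₀ z - μs) ^ 2 + b * (F.estimator x₀ n₀ z - μs) ^ 3))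
        ∂(Measure.pi fun _ => P)| ≤ (Cp + Cm) / ((n : ℝ) + 1) ^ 2 := by
    have h1 := norm_integral_le_of_norm_le (f := fun z : Fin n → 𝒵 =>
      F.divergence μs (F.estimator x₀ n₀ z) - (a * (F.estimator x₀ n₀ z - μs) ^ 2 +
        b * (F.estimator x₀ n₀ z - μs) ^ 3)) ((hBp n).add (hBm n)) (hrem n)
    rw [Real.norm_eq_abs] at h1
    refine h1.trans ?_
    simp only [Pi.add_apply]
    rw [integral_add (hBp n) (hBm n), add_div]
    exact add_le_add (hCp n) (hCm n)
  set I₁ := ∫ z : Fin n → 𝒵, (F.divergence μs (F.estimator x₀ n₀ z) -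
        (a * (F.estimator x₀ n₀ z - μs) ^ 2 + b * (F.estimator x₀ n₀ z - μs) ^ 3))
        ∂(Measure.pi fun _ => P)
  set I₂ := ∫ z : Fin n → 𝒵, (shrunkMean F.X x₀ n₀ z - μs) ^ 2 ∂(Measure.pi fun _ => P)
  set I₃ := ∫ z : Fin n → 𝒵, (shrunkMean F.X x₀ n₀ z - μs) ^ 3 ∂(Measure.pi fun _ => P)
  set s := ∫ z, (F.X z - μs) ^ 2 ∂P
  have e2 : I₁ + (a * I₂ + b * I₃) - a * s / (n + 1) =
      a * (I₂ - s / (n + 1)) + b * I₃ + I₁ := by ring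
  rw [e1, e2, add_div, add_div, mul_div_assoc, mul_div_assoc]
  refine (abs_add_le _ _).trans (add_le_add ((abs_add_le _ _).trans (add_le_add ?_ ?_)) hr)
  · rw [abs_mul]
    exact mul_le_mul_of_nonneg_left (hC₂ n) (abs_nonneg _)
  · rw [abs_mul]
    exact mul_le_mul_of_nonneg_left (hC₃ n) (abs_nonneg _)

/-! ### Expected codelengths. -/

theorem neg_log_meanDensity (hinj : F.IsIdentifiable) {μ : ℝ} (hμ : μ ∈ F.meanSpace) {z : 𝒵}
    (hz : 0 < F.h z) : -Real.log (F.meanDensity μ z) =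
      F.natParam μ * F.X z + (F.logPartition (F.natParam μ) - Real.log (F.h z)) := by
  have hZ := toReal_partitionFn_pos hinj (natParam_mem hμ)
  have hz' : ((F.h z : ℝ≥0) : ℝ) ≠ 0 := by exact_mod_cast hz.ne'
  rw [meanDensity, density, Real.log_div (mul_ne_zero (Real.exp_pos _).ne' hz') hZ.ne',
    Real.log_mul (Real.exp_pos _).ne' hz', Real.log_exp, log_toReal_partitionFn]
  ring

theorem neg_log_meanDensity_eq_divergence (hreg : F.IsRegular) (hinj : F.IsIdentifiable)
    (hμs : μs ∈ F.meanSpace) {μ : ℝ} (hμ : μ ∈ F.meanSpace) {z : 𝒵}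
    (hz : 0 < F.h z) : -Real.log (F.meanDensity μ z) =
      (F.natParam μ - F.natParam μs) * (F.X z - μs) + F.divergence μs μ +
        -Real.log (F.meanDensity μs z) := by
  rw [neg_log_meanDensity hinj hμ hz, neg_log_meanDensity hinj hμs hz,
    divergence_eq hreg hinj hμs hμ]
  ring

theorem integrable_neg_log_meanDensity (hinj : F.IsIdentifiable) (hint : Integrable F.X P)
    (hpos : ∀ᵐ z ∂P, 0 < F.h z) (hlog : Integrable (fun z => Real.log (F.h z)) P) {μ : ℝ}
    (hμ : μ ∈ F.meanSpace) : Integrable (fun z => -Real.log (F.meanDensity μ z)) P := by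
  refine ((hint.const_mul (F.natParam μ)).add
    ((integrable_const (F.logPartition (F.natParam μ))).sub hlog)).congr ?_
  filter_upwards [hpos] with z hz using (neg_log_meanDensity hinj hμ hz).symm

theorem integral_neg_log_meanDensity (hreg : F.IsRegular) (hinj : F.IsIdentifiable)
    (hμs : μs ∈ F.meanSpace) (hint : Integrable F.X P) (hmean : ∫ z, F.X z ∂P = μs)
    (hpos : ∀ᵐ z ∂P, 0 < F.h z) (hlog : Integrable (fun z => Real.log (F.h z)) P) {μ : ℝ}
    (hμ : μ ∈ F.meanSpace) : ∫ z, -Real.log (F.meanDensity μ z) ∂P =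
      F.divergence μs μ + ∫ z, -Real.log (F.meanDensity μs z) ∂P := by
  have hI := integrable_neg_log_meanDensity hinj hint hpos hlog hμs
  have h1 : Integrable (fun z => (F.natParam μ - F.natParam μs) * (F.X z - μs)) P :=
    (hint.sub (integrable_const _)).const_mul _
  have h2 : Integrable (fun z => (F.natParam μ - F.natParam μs) * (F.X z - μs) +
      F.divergence μs μ) P := h1.add (integrable_const _)
  rw [integral_congr_ae (g := fun z => (F.natParam μ - F.natParam μs) * (F.X z - μs) +
      F.divergence μs μ + -Real.log (F.meanDensity μs z)) ?_,
    integral_add h2 hI, integral_add h1 (integrable_const _), integral_const_mul,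
    integral_sub hint (integrable_const _), hmean]
  · simp
  · filter_upwards [hpos] with z hz using neg_log_meanDensity_eq_divergence hreg hinj hμs hμ hz

theorem codeLength_ae_eq (hinj : F.IsIdentifiable)
    (hpos : ∀ᵐ z ∂P, 0 < F.h z) {μ : ℝ} (hμ : μ ∈ F.meanSpace) (n : ℕ) :
    (fun z : Fin n → 𝒵 => F.codeLength μ z) =ᵐ[Measure.pi fun _ => P]
      fun z => ∑ i, -Real.log (F.meanDensity μ (z i)) := by
  filter_upwards [ae_pi_forall hpos n] with z hz
  rw [codeLength, Real.log_prod, Finset.sum_neg_distrib]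
  intro i _
  have hZ := toReal_partitionFn_pos hinj (natParam_mem hμ)
  have : (0 : ℝ) < F.h (z i) := by exact_mod_cast hz i
  rw [meanDensity, density]
  positivity

theorem integrable_codeLength (hinj : F.IsIdentifiable) (hint : Integrable F.X P)
    (hpos : ∀ᵐ z ∂P, 0 < F.h z) (hlog : Integrable (fun z => Real.log (F.h z)) P) {μ : ℝ}
    (hμ : μ ∈ F.meanSpace) (n : ℕ) :
    Integrable (fun z : Fin n → 𝒵 => F.codeLength μ z) (Measure.pi fun _ => P) := by
  refine (integrable_congr (codeLength_ae_eq hinj hpos hμ n)).mpr ?_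
  exact integrable_finsetSum _ fun i _ => integrable_comp_eval (μ := fun _ : Fin n => P) (i := i)
    (integrable_neg_log_meanDensity hinj hint hpos hlog hμ)

theorem integral_codeLength (hreg : F.IsRegular) (hinj : F.IsIdentifiable)
    (hμs : μs ∈ F.meanSpace) (hint : Integrable F.X P) (hmean : ∫ z, F.X z ∂P = μs)
    (hpos : ∀ᵐ z ∂P, 0 < F.h z) (hlog : Integrable (fun z => Real.log (F.h z)) P) {μ : ℝ}
    (hμ : μ ∈ F.meanSpace) (n : ℕ) :
    ∫ z : Fin n → 𝒵, F.codeLength μ z ∂(Measure.pi fun _ => P) =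
      n * (F.divergence μs μ + ∫ z, -Real.log (F.meanDensity μs z) ∂P) := by
  have hI := integrable_neg_log_meanDensity hinj hint hpos hlog hμ
  rw [integral_congr_ae (codeLength_ae_eq hinj hpos hμ n), integral_finsetSum _ fun i _ =>
    integrable_comp_eval (μ := fun _ : Fin n => P) (i := i) hI]
  rw [Finset.sum_congr rfl fun i _ => (integral_comp_eval (μ := fun _ : Fin n => P) (i := i)
    hI.aestronglyMeasurable).trans
      (integral_neg_log_meanDensity hreg hinj hμs hint hmean hpos hlog hμ)]
  rw [Finset.sum_const, Finset.card_univ, Fintype.card_fin, nsmul_eq_mul]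

/-- The infimal expected codelength is attained at the mean of the data-generating distribution. -/
theorem isLeast_integral_codeLength (hreg : F.IsRegular) (hinj : F.IsIdentifiable)
    (hμs : μs ∈ F.meanSpace) (hint : Integrable F.X P) (hmean : ∫ z, F.X z ∂P = μs)
    (hpos : ∀ᵐ z ∂P, 0 < F.h z) (hlog : Integrable (fun z => Real.log (F.h z)) P) (n : ℕ) :
    IsLeast (Set.range fun μ : F.meanSpace =>
      ∫ z : Fin n → 𝒵, F.codeLength (μ : ℝ) z ∂(Measure.pi fun _ => P))
      (n * ∫ z, -Real.log (F.meanDensity μs z) ∂P) := by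
  refine ⟨⟨⟨μs, hμs⟩, ?_⟩, ?_⟩
  · simp only
    rw [integral_codeLength hreg hinj hμs hint hmean hpos hlog hμs, divergence_self hreg hinj hμs,
      zero_add]
  · rintro _ ⟨⟨μ, hμ⟩, rfl⟩
    simp only
    rw [integral_codeLength hreg hinj hμs hint hmean hpos hlog hμ]
    have := divergence_nonneg (F := F) μs μ
    gcongr
    linarith

/-- The codelength of the next outcome, given the outcomes observed so far. -/
noncomputable def stepLength (F : ExpFamily 𝒵) (x₀ n₀ : ℝ) {n : ℕ} (w : (Fin n → 𝒵) × 𝒵) : ℝ :=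
  -Real.log (F.meanDensity (F.estimator x₀ n₀ w.1) w.2)

theorem preqLength_succ (F : ExpFamily 𝒵) (x₀ n₀ : ℝ) {n : ℕ} (z : Fin (n + 1) → 𝒵) :
    F.preqLength x₀ n₀ z = F.preqLength x₀ n₀ (fun j : Fin n => z j.castSucc) +
      F.stepLength x₀ n₀ ((fun j : Fin n => z j.castSucc), z (Fin.last n)) := by
  rw [preqLength, Fin.sum_univ_castSucc]
  rfl

/-- The cross term is a function of the past times X - μs of the new outcome; by independence its
mean factors, and the second factor is 0. -/
theorem stepLength_integrable_and_integral (hreg : F.IsRegular) (hinj : F.IsIdentifiable)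
    (hμs : μs ∈ F.meanSpace) (hint : Integrable F.X P) (hmean : ∫ z, F.X z ∂P = μs)
    (hpos : ∀ᵐ z ∂P, 0 < F.h z) (hlog : Integrable (fun z => Real.log (F.h z)) P)
    (hsupp : ∀ᵐ z ∂P, F.X z ∈ closure F.meanSpace) (hx₀ : x₀ ∈ F.meanSpace) (hn₀ : 0 < n₀)
    {n : ℕ} (hdiv : Integrable (fun z : Fin n → 𝒵 => F.divergence μs (F.estimator x₀ n₀ z))
      (Measure.pi fun _ => P)) :
    Integrable (F.stepLength x₀ n₀ (n := n)) ((Measure.pi fun _ => P).prod P) ∧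
    ∫ w, F.stepLength x₀ n₀ (n := n) w ∂((Measure.pi fun _ => P).prod P) =
      ∫ z : Fin n → 𝒵, F.divergence μs (F.estimator x₀ n₀ z) ∂(Measure.pi fun _ => P) +
        ∫ z, -Real.log (F.meanDensity μs z) ∂P := by
  set Q : Measure (Fin n → 𝒵) := Measure.pi fun _ => P with hQ
  have hmem := ae_estimator_mem hreg hinj hsupp hx₀ hn₀ n
  have hae : F.stepLength x₀ n₀ (n := n) =ᵐ[Q.prod P] fun w =>
      (F.natParam (F.estimator x₀ n₀ w.1) - F.natParam μs) * (F.X w.2 - μs) +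
        F.divergence μs (F.estimator x₀ n₀ w.1) + -Real.log (F.meanDensity μs w.2) := by
    filter_upwards [Measure.quasiMeasurePreserving_fst.ae hmem,
      Measure.quasiMeasurePreserving_snd.ae hpos] with w h1 h2
    exact neg_log_meanDensity_eq_divergence hreg hinj hμs h1 h2
  -- Integrability of the natural parameter of the estimator, needed to factor the cross term, is
  -- inherited from that of the divergence.
  obtain ⟨C, D, hCD⟩ := exists_abs_natParam_sub_le hreg hinj hμs
  have hnat : Integrable (fun z : Fin n → 𝒵 =>
      F.natParam (F.estimator x₀ n₀ z) - F.natParam μs) Q := by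
    refine ((integrable_const C).add (hdiv.const_mul D)).mono' ?_ ?_
    · refine aestronglyMeasurable_comp_estimator
        (g := fun μ => F.natParam μ - F.natParam μs) hreg hinj hsupp hx₀ hn₀ ?_ n
      exact fun μ hμ => ((hasDerivAt_natParam hreg hinj hμ).continuousAt.sub
        continuousAt_const).continuousWithinAt
    · filter_upwards [hmem] with z hz using hCD _ hz
  have hX : Integrable (fun z => F.X z - μs) P := hint.sub (integrable_const _)
  have hX0 : ∫ z, (F.X z - μs) ∂P = 0 := by
    rw [integral_sub hint (integrable_const _), hmean]
    simp
  have hI := integrable_neg_log_meanDensity hinj hint hpos hlog hμs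
  have j1 : Integrable (fun w : (Fin n → 𝒵) × 𝒵 =>
      (F.natParam (F.estimator x₀ n₀ w.1) - F.natParam μs) * (F.X w.2 - μs)) (Q.prod P) :=
    hnat.mul_prod hX
  have j2 : Integrable (fun w : (Fin n → 𝒵) × 𝒵 => F.divergence μs (F.estimator x₀ n₀ w.1))
      (Q.prod P) := hdiv.comp_fst P
  have j3 : Integrable (fun w : (Fin n → 𝒵) × 𝒵 => -Real.log (F.meanDensity μs w.2))
      (Q.prod P) := hI.comp_snd Q
  have j12 : Integrable (fun w : (Fin n → 𝒵) × 𝒵 =>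
      (F.natParam (F.estimator x₀ n₀ w.1) - F.natParam μs) * (F.X w.2 - μs) +
        F.divergence μs (F.estimator x₀ n₀ w.1)) (Q.prod P) := j1.add j2
  refine ⟨(integrable_congr hae).mpr (j12.add j3), ?_⟩
  rw [integral_congr_ae hae, integral_add j12 j3, integral_add j1 j2,
    integral_prod_mul (fun z : Fin n → 𝒵 => F.natParam (F.estimator x₀ n₀ z) - F.natParam μs)
      (fun z => F.X z - μs), hX0,
    integral_fun_fst (fun z : Fin n → 𝒵 => F.divergence μs (F.estimator x₀ n₀ z)),
    integral_fun_snd (fun z => -Real.log (F.meanDensity μs z))]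
  simp

theorem preqLength_integrable_and_integral (hreg : F.IsRegular) (hinj : F.IsIdentifiable)
    (hμs : μs ∈ F.meanSpace) (hint : Integrable F.X P) (hmean : ∫ z, F.X z ∂P = μs)
    (hpos : ∀ᵐ z ∂P, 0 < F.h z) (hlog : Integrable (fun z => Real.log (F.h z)) P)
    (hsupp : ∀ᵐ z ∂P, F.X z ∈ closure F.meanSpace) (hx₀ : x₀ ∈ F.meanSpace) (hn₀ : 0 < n₀)
    (hdiv : ∀ n, Integrable (fun z : Fin n → 𝒵 => F.divergence μs (F.estimator x₀ n₀ z))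
      (Measure.pi fun _ => P)) (n : ℕ) :
    Integrable (fun z : Fin n → 𝒵 => F.preqLength x₀ n₀ z) (Measure.pi fun _ => P) ∧
    ∫ z : Fin n → 𝒵, F.preqLength x₀ n₀ z ∂(Measure.pi fun _ => P) =
      ∑ i ∈ Finset.range n,
        ∫ z : Fin i → 𝒵, F.divergence μs (F.estimator x₀ n₀ z) ∂(Measure.pi fun _ => P) +
        n * ∫ z, -Real.log (F.meanDensity μs z) ∂P := by
  induction n with
  | zero => simp [preqLength]
  | succ n ih =>
    obtain ⟨hs, hsI⟩ := stepLength_integrable_and_integral hreg hinj hμs hint hmean hpos hlog hsupp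
      hx₀ hn₀ (hdiv n)
    have h1 : Integrable (fun w : (Fin n → 𝒵) × 𝒵 => F.preqLength x₀ n₀ w.1)
      ((Measure.pi fun _ => P).prod P) := ih.1.comp_fst P
    have h2 := h1.add hs
    have h3 := integral_pi_succ h2.aestronglyMeasurable
    simp only [Pi.add_apply] at h3
    simp_rw [preqLength_succ]
    refine ⟨integrable_pi_succ h2, h3.trans ?_⟩
    rw [integral_add h1 hs, hsI,
      integral_fun_fst (fun z : Fin n → 𝒵 => F.preqLength x₀ n₀ z), ih.2, Finset.sum_range_succ]
    simp
    ring

end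

end ExpFamily

/-! ### Summation of the increments and the main theorem. -/

/-- A sequence with increments `a / (i + 1) + O(1 / (i + 1) ^ 2)` is `a log n + O(1)`. -/
theorem sum_sub_mul_log_isBigO {u : ℕ → ℝ} {a C : ℝ}
    (hu : ∀ n : ℕ, |u n - a / (n + 1)| ≤ C / ((n : ℝ) + 1) ^ 2) :
    (fun n : ℕ => ∑ i ∈ Finset.range n, u i - a * Real.log n) =O[atTop] (fun _ => (1 : ℝ)) := by
  have hsum : Summable fun n : ℕ => C / ((n : ℝ) + 1) ^ 2 := by
    have h := (summable_nat_add_iff 1).mpr (Real.summable_nat_pow_inv.mpr one_lt_two)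
    simpa [div_eq_mul_inv] using h.mul_left C
  have hC : ∀ n : ℕ, 0 ≤ C / ((n : ℝ) + 1) ^ 2 := fun n => (abs_nonneg _).trans (hu n)
  refine IsBigO.of_bound (∑' n : ℕ, C / ((n : ℝ) + 1) ^ 2 + |a|) ?_
  filter_upwards [eventually_ge_atTop 1] with n hn
  have hn' : (0 : ℝ) < n := by exact_mod_cast hn
  rw [norm_one, mul_one, Real.norm_eq_abs]
  have hh : ((harmonic n : ℚ) : ℝ) = ∑ i ∈ Finset.range n, 1 / ((i : ℝ) + 1) := by
    simp [harmonic]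
  have e : ∑ i ∈ Finset.range n, u i - a * Real.log n =
      ∑ i ∈ Finset.range n, (u i - a / (i + 1)) + a * ((harmonic n : ℚ) - Real.log n) := by
    rw [hh, mul_sub, Finset.mul_sum, Finset.sum_sub_distrib]
    simp only [mul_one_div]
    ring
  rw [e]
  refine (abs_add_le _ _).trans (add_le_add ?_ ?_)
  · exact (Finset.abs_sum_le_sum_abs _ _).trans
      ((Finset.sum_le_sum fun i _ => hu i).trans (hsum.sum_le_tsum _ fun i _ => hC i))
  · rw [abs_mul]
    -- The harmonic number differs from log n by a number in [0, 1].
    refine mul_le_of_le_one_right (abs_nonneg a) (abs_le.mpr ⟨?_, ?_⟩)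
    · have h1 := log_add_one_le_harmonic n
      have h2 : Real.log n ≤ Real.log ↑(n + 1) := Real.log_le_log hn' (by push_cast; linarith)
      linarith
    · linarith [harmonic_le_one_add_log n]

theorem theorem1 {𝒵 : Type*} [MeasurableSpace 𝒵] (F : ExpFamily 𝒵)
    (hreg : F.IsRegular) (hinj : F.IsIdentifiable)
    (P : Measure 𝒵) [IsProbabilityMeasure P]
    (μs : ℝ) (hμs : μs ∈ F.meanSpace)
    (hint : Integrable F.X P) (hmean : ∫ z, F.X z ∂P = μs)
    -- the codelengths under the family are finite, almost surely and in expectation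
    (hpos : ∀ᵐ z ∂P, 0 < F.h z) (hlog : Integrable (fun z => Real.log (F.h z)) P)
    -- the estimators stay in the mean value parameter space
    (hsupp : ∀ᵐ z ∂P, F.X z ∈ closure F.meanSpace)
    (x₀ n₀ : ℝ) (hx₀ : x₀ ∈ F.meanSpace) (hn₀ : 0 < n₀)
    (hcond : F.GrowthCondition P μs) :
    (∀ n : ℕ, Integrable (fun z : Fin n → 𝒵 => F.preqLength x₀ n₀ z) (Measure.pi fun _ => P)) ∧
    (∀ n : ℕ, ∀ μ ∈ F.meanSpace,
      Integrable (fun z : Fin n → 𝒵 => F.codeLength μ z) (Measure.pi fun _ => P)) ∧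
    (∀ n : ℕ, BddBelow (Set.range fun μ : F.meanSpace =>
      ∫ z : Fin n → 𝒵, F.codeLength (μ : ℝ) z ∂(Measure.pi fun _ => P))) ∧
    (fun n : ℕ => F.redundancy P x₀ n₀ n -
        Var[F.X; P] / Var[F.X; F.meanDist μs] * (1 / 2) * Real.log n)
      =O[atTop] (fun _ => (1 : ℝ)) := by
  obtain ⟨hdiv, C, hC⟩ := ExpFamily.integrable_divergence_estimator hreg hinj hμs hint hmean hsupp
    hx₀ hn₀ hcond
  have hpreq := ExpFamily.preqLength_integrable_and_integral hreg hinj hμs hint hmean hpos hlog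
    hsupp hx₀ hn₀ hdiv
  have hleast := ExpFamily.isLeast_integral_codeLength hreg hinj hμs hint hmean hpos hlog
  refine ⟨fun n => (hpreq n).1,
    fun n μ hμ => ExpFamily.integrable_codeLength hinj hint hpos hlog hμ n,
    fun n => ⟨_, (hleast n).2⟩, (sum_sub_mul_log_isBigO hC).congr_left fun n => ?_⟩
  -- The n-fold expected codelength of M_μ* cancels, leaving the sum of expected divergences.
  rw [ExpFamily.redundancy, (hpreq n).2, iInf, (hleast n).csInf_eq,
    variance_eq_integral hint.aemeasurable, hmean]
  change _ = _ - _ / F.varAt (F.natParam μs) * (1 / 2) * _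
  ring
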